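/- Let $k$ be a field. For $n\ge 1$ let $\mathrm{Mould}(n)=k(u_1,\dots,u_n)$ be the space of rational (homogeneous) moulds of degree $n$, with unit $1/u_1\in\mathrm{Mould}(1)$, with the partial compositions, for $f\in\mathrm{Mould}(m)$, $g\in\mathrm{Mould}(n)$, $1\le i\le m$, $$(f\circ_i g)(u_1,\dots,u_{m+n-1})=(u_i+\cdots+u_{i+n-1})\,f(u_1,\dots,u_{i-1},u_i+\cdots+u_{i+n-1},u_{i+n},\dots,u_{m+n-1})\,g(u_i,\dots,u_{i+n-1}),$$ with the action of $\mathfrak S_n$ given by $(\sigma f)(u_1,\dots,u_n)=f(u_{\sigma(1)},\dots,u_{\sigma(n)})$, and with the action of the $(n+1)$-cycle $$(\gamma f)(u_1,\dots,u_n)=f(u_2,u_3,\dots,u_n,-u_1-\cdots-u_n).$$ These data form an anticyclic (symmetric) operad: an operad such that the $\mathfrak S_n$-actions and $\gamma$ come from linear actions of the groups $\mathfrak S_{n+1}$, and such that $\gamma(1)=-1$ for the unit $1$, $\gamma(f\circ_i g)=\gamma(f)\circ_{i+1}g$ for $1\le i<m$, and $\gamma(f\circ_m g)=-\gamma(g)\circ_1\gamma(f)$.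 For $\sigma\in\mathfrak S_n$ let $$f_\sigma=\frac1{u_{\sigma(1)}(u_{\sigma(1)}+u_{\sigma(2)})\cdots(u_{\sigma(1)}+\cdots+u_{\sigma(n)})}$$ be the permutational mould of $\sigma$ (the kernel of the operator $F_\sigma$), and write $\sigma$ also for the word $\sigma(1)\cdots\sigma(n)$. Then: 1. For $m,n\ge1$ and $1\le i\le m$, $$f_{\mathrm{Id}_m}\circ_i f_{\mathrm{Id}_n}=\sum_\sigma f_\sigma ,$$ the sum being over the permutations $\sigma\in\mathfrak S_{m+n-1}$ in $\big((1,\dots,i-1)\,\sqcup\!\sqcup \,(i,\dots,i+n-2)\big)\cdot(i+n-1,\dots,m+n-1)$, where $\sqcup\!\sqcup $ is the shuffle of words and $\cdot$ is concatenation. 2. For $\sigma\in\mathfrak S_n$, let $\sigma'$ be the word in the letters $1,\dots,n$ with $\sigma'(i)\equiv\sigma(i)+1 \bmod n$, write $\sigma'=a\,1\,w$ and $b=1\,\bar w$, where $\bar w$ is the mirror image of $w$. Then $\gamma f_\sigma=(-1)^{|b|}\sum_{\tau\in a\,\sqcup\!\sqcup \,b}f_\tau$. 3. The linear spans of $\{f_\sigma:\sigma\in\mathfrak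 S_n\}$, $n\ge1$, contain the unit and are stable under all the compositions $\circ_i$ and under the symmetric groups, so they form a suboperad of $\mathrm{Mould}$. They are stable under $\gamma$, and with this $\gamma$ the suboperad is an anticyclic operad. 4. This suboperad is isomorphic, as a symmetric operad, to Loday's operad $\mathrm{Zinbiel}$, the operad of algebras with one bilinear product satisfying $(xy)z=x(yz)+x(zy)$ (its $n$-ary operations are the multilinear elements of the free such algebra on $x_1,\dots,x_n$). The isomorphism can be chosen to match the permutations up to mirror image: for every $\sigma\in\mathfrak S_n$ it sends the operation $x_{\sigma(1)}(x_{\sigma(2)}(\cdots x_{\sigma(n)}))$, i.e. the word $x_{\sigma(1)}\cdots x_{\sigma(n)}$, to $f_{\sigma(n)\cdots\sigma(2)\sigma(1)}$. -/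

import Mathlib

universe u v w

/-! ## Symmetric operads with partial compositions, in arities `1, 2, 3, …` -/

/-- The position, among the `N = m + n - 1` inputs of a partial composition `f ∘_i g`, of the
`j`-th input of `g` (all positions are counted from `0`). -/
def innerPos {m n N : ℕ+} (h : (N : ℕ) + 1 = m + n) (i : Fin m) (j : Fin n) : Fin N :=
  ⟨i + j, by have := i.isLt; have := j.isLt; omega⟩

/-- The position, among the `N = m + n - 1` inputs of `f ∘_i g`, of the `j`-th input of `f`,
for `j ≠ i`.  (For `j = i` this is the position of the first input of `g`.) -/
def outerPos {m n N : ℕ+} (h : (N : ℕ) + 1 = m + n) (i j : Fin m) : Fin N :=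
  ⟨if j ≤ i then j else j + n - 1, by
    have := i.isLt; have := j.isLt; have := n.pos; split_ifs <;> omega⟩

/-- The data of a (not yet axiomatized) `k`-linear symmetric operad without nullary operations:
the spaces of operations, the unit, the partial compositions `f ∘_i g` and the left actions of
the symmetric groups.  The arity of `comp h i f g` is the `N` with `N = m + n - 1`. -/
structure PreOperad (k : Type u) [Field k] where
  Obj : ℕ+ → Type v
  [addCommGroup : ∀ n, AddCommGroup (Obj n)]
  [module : ∀ n, Module k (Obj n)]
  one : Obj 1
  comp : ∀ {m n N : ℕ+}, (N : ℕ) + 1 = m + n → Fin m → Obj m → Obj n → Obj N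
  act : ∀ {n : ℕ+}, Equiv.Perm (Fin n) → Obj n → Obj n

attribute [instance] PreOperad.addCommGroup PreOperad.module

namespace PreOperad

variable {k : Type u} [Field k]

/-- The axioms of a symmetric operad. In the equivariance axiom, `ρ` is the permutation of the
`N` inputs that permutes the block of inputs of `g` by `τ` and the other inputs by `σ`. -/
structure IsOperad (P : PreOperad.{u, v} k) : Prop where
  act_one : ∀ {n : ℕ+} (f : P.Obj n), P.act 1 f = f
  act_mul : ∀ {n : ℕ+} (σ τ : Equiv.Perm (Fin n)) (f : P.Obj n),
    P.act (σ * τ) f = P.act σ (P.act τ f)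
  act_linear : ∀ {n : ℕ+} (σ : Equiv.Perm (Fin n)), IsLinearMap k (P.act σ)
  comp_linear_left : ∀ {m n N : ℕ+} (h : (N : ℕ) + 1 = m + n) (i : Fin m) (g : P.Obj n),
    IsLinearMap k (fun f => P.comp h i f g)
  comp_linear_right : ∀ {m n N : ℕ+} (h : (N : ℕ) + 1 = m + n) (i : Fin m) (f : P.Obj m),
    IsLinearMap k (fun g => P.comp h i f g)
  comp_one : ∀ {m : ℕ+} (h : (m : ℕ) + 1 = m + (1 : ℕ+)) (i : Fin m) (f : P.Obj m),
    P.comp h i f P.one = f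
  one_comp : ∀ {n : ℕ+} (h : (n : ℕ) + 1 = (1 : ℕ+) + n) (i : Fin (1 : ℕ+)) (g : P.Obj n),
    P.comp h i P.one g = g
  comp_assoc : ∀ {l m n M L N : ℕ+} (h₁ : (M : ℕ) + 1 = l + m) (h₂ : (N : ℕ) + 1 = M + n)
    (h₃ : (L : ℕ) + 1 = m + n) (h₄ : (N : ℕ) + 1 = l + L) (i : Fin l) (j : Fin m)
    (f : P.Obj l) (g : P.Obj m) (e : P.Obj n),
    P.comp h₂ (innerPos h₁ i j) (P.comp h₁ i f g) e = P.comp h₄ i f (P.comp h₃ j g e)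
  comp_comm : ∀ {l m n M L N : ℕ+} (h₁ : (M : ℕ) + 1 = l + m) (h₂ : (N : ℕ) + 1 = M + n)
    (h₃ : (L : ℕ) + 1 = l + n) (h₄ : (N : ℕ) + 1 = L + m) (i j : Fin l), i < j →
    ∀ (f : P.Obj l) (g : P.Obj m) (e : P.Obj n),
    P.comp h₂ (outerPos h₁ i j) (P.comp h₁ i f g) e =
      P.comp h₄ (outerPos h₃ j i) (P.comp h₃ j f e) g
  comp_act : ∀ {m n N : ℕ+} (h : (N : ℕ) + 1 = m + n) (i : Fin m) (σ : Equiv.Perm (Fin m))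
    (τ : Equiv.Perm (Fin n)) (ρ : Equiv.Perm (Fin N)),
    (∀ j, j ≠ i → ρ (outerPos h i j) = outerPos h (σ i) (σ j)) →
    (∀ j, ρ (innerPos h i j) = innerPos h (σ i) (τ j)) →
    ∀ (f : P.Obj m) (g : P.Obj n),
    P.comp h (σ i) (P.act σ f) (P.act τ g) = P.act ρ (P.comp h i f g)

/-- The operad `P` is anticyclic, the `(n+1)`-cycles acting by `γ`: the maps `γ` and the actions
of the symmetric groups `S_n` come from linear actions of the groups `S_{n+1}` (`S_n` being the
stabilizer of the last point, and `γ` the action of the cycle `j ↦ j + 1`), and `γ` satisfies the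
anticyclic compatibilities with the unit and with the partial compositions. -/
structure IsAnticyclic (P : PreOperad.{u, v} k) (γ : ∀ n : ℕ+, P.Obj n → P.Obj n) : Prop where
  isOperad : P.IsOperad
  exists_action : ∀ n : ℕ+, ∃ ρ : Equiv.Perm (Fin (n + 1)) →* Module.End k (P.Obj n),
    (∀ (σ : Equiv.Perm (Fin n)) (σ' : Equiv.Perm (Fin (n + 1))),
      σ' (Fin.last n) = Fin.last n → (∀ j : Fin n, σ' j.castSucc = (σ j).castSucc) →
      ∀ f, ρ σ' f = P.act σ f) ∧
    ∀ f, ρ (finRotate (n + 1)) f = γ n f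
  cycle_one : γ 1 P.one = -P.one
  cycle_comp : ∀ {m n N : ℕ+} (h : (N : ℕ) + 1 = m + n) (i : Fin m) (hi : (i : ℕ) + 1 < m)
    (f : P.Obj m) (g : P.Obj n),
    γ N (P.comp h i f g) = P.comp h ⟨(i : ℕ) + 1, hi⟩ (γ m f) g
  cycle_comp_last : ∀ {m n N : ℕ+} (h : (N : ℕ) + 1 = m + n) (h' : (N : ℕ) + 1 = n + m)
    (i : Fin m), (i : ℕ) + 1 = m → ∀ (f : P.Obj m) (g : P.Obj n),
    γ N (P.comp h i f g) = -P.comp h' ⟨0, n.pos⟩ (γ n g) (γ m f)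

/-- A family of subspaces that contains the unit and is stable under the partial compositions
and the symmetric groups. -/
structure IsSuboperad (P : PreOperad.{u, v} k) (S : ∀ n, Submodule k (P.Obj n)) : Prop where
  one_mem : P.one ∈ S 1
  comp_mem : ∀ {m n N : ℕ+} (h : (N : ℕ) + 1 = m + n) (i : Fin m) {f : P.Obj m} {g : P.Obj n},
    f ∈ S m → g ∈ S n → P.comp h i f g ∈ S N
  act_mem : ∀ {n : ℕ+} (σ : Equiv.Perm (Fin n)) {f : P.Obj n}, f ∈ S n → P.act σ f ∈ S n

/-- The restriction of the operations to a suboperad. -/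
def restrict (P : PreOperad.{u, v} k) (S : ∀ n, Submodule k (P.Obj n)) (hS : P.IsSuboperad S) :
    PreOperad.{u, v} k where
  Obj n := S n
  one := ⟨P.one, hS.one_mem⟩
  comp h i f g := ⟨P.comp h i f g, hS.comp_mem h i f.2 g.2⟩
  act σ f := ⟨P.act σ f, hS.act_mem σ f.2⟩

/-- Isomorphisms of symmetric operads. -/
structure Iso (P Q : PreOperad.{u, v} k) where
  equiv : ∀ n, P.Obj n ≃ₗ[k] Q.Obj n
  map_one : equiv 1 P.one = Q.one
  map_comp : ∀ {m n N : ℕ+} (h : (N : ℕ) + 1 = m + n) (i : Fin m) (f : P.Obj m) (g : P.Obj n),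
    equiv N (P.comp h i f g) = Q.comp h i (equiv m f) (equiv n g)
  map_act : ∀ {n : ℕ+} (σ : Equiv.Perm (Fin n)) (f : P.Obj n),
    equiv n (P.act σ f) = Q.act σ (equiv n f)

end PreOperad

/-! ## The operad of moulds -/

section Mould

variable (k : Type u) [Field k]

/-- Homogeneous (rational) moulds of degree `n`: rational functions in `u_1, …, u_n`. -/
abbrev Mould (n : ℕ) : Type u := FractionRing (MvPolynomial (Fin n) k)

namespace Mould

/-- The variables `u_1, …, u_n` (indexed from `0`). -/
noncomputable def u {n : ℕ} (j : Fin n) : Mould k n :=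
  algebraMap (MvPolynomial (Fin n) k) (Mould k n) (MvPolynomial.X j)

variable {k}

/-- The substitution `f ↦ f(v_1, …, v_m)`, for algebraically independent `v_1, …, v_m`. -/
noncomputable def subst {m N : ℕ} (v : Fin m → Mould k N) (hv : AlgebraicIndependent k v) :
    Mould k m →ₐ[k] Mould k N :=
  IsFractionRing.liftAlgHom (g := MvPolynomial.aeval v) hv

variable (k)

theorem algebraicIndependent_u (n : ℕ) : AlgebraicIndependent k (u k : Fin n → Mould k n) :=
  (MvPolynomial.algebraicIndependent_X (Fin n) k).map'
    (f := IsScalarTower.toAlgHom k (MvPolynomial (Fin n) k) (Mould k n))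
    (IsFractionRing.injective _ _)

/-- A criterion: polynomials with a common left inverse substitution are independent. -/
theorem algebraicIndependent_of_leftInverse {m N : ℕ} (w : Fin m → MvPolynomial (Fin N) k)
    (r : Fin N → MvPolynomial (Fin m) k)
    (h : ∀ j, MvPolynomial.aeval r (w j) = MvPolynomial.X j) :
    AlgebraicIndependent k
      (fun j => algebraMap (MvPolynomial (Fin N) k) (Mould k N) (w j)) := by
  have h1 : AlgebraicIndependent k w := by
    apply AlgebraicIndependent.of_comp (MvPolynomial.aeval r)
    have : (⇑(MvPolynomial.aeval r : MvPolynomial (Fin N) k →ₐ[k] MvPolynomial (Fin m) k)) ∘ w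
        = MvPolynomial.X := funext h
    rw [this]
    exact MvPolynomial.algebraicIndependent_X _ _
  exact h1.map' (f := IsScalarTower.toAlgHom k (MvPolynomial (Fin N) k) (Mould k N))
    (IsFractionRing.injective _ _)

/-- The arguments `u_i, …, u_{i+n-1}` of `g` in `f ∘_i g`. -/
noncomputable def innerArgs {m n N : ℕ+} (h : (N : ℕ) + 1 = m + n) (i : Fin m) (j : Fin n) :
    Mould k N := u k (innerPos h i j)

/-- The arguments `u_1, …, u_{i-1}, u_i + ⋯ + u_{i+n-1}, u_{i+n}, …, u_{m+n-1}` of `f` in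
`f ∘_i g`. -/
noncomputable def outerArgs {m n N : ℕ+} (h : (N : ℕ) + 1 = m + n) (i j : Fin m) :
    Mould k N :=
  if j = i then ∑ l : Fin n, u k (innerPos h i l) else u k (outerPos h i j)

/-- The arguments `u_2, u_3, …, u_n, -u_1 - u_2 - ⋯ - u_n`. -/
noncomputable def cycleArgs (n : ℕ) (j : Fin n) : Mould k n :=
  if hj : (j : ℕ) + 1 < n then u k ⟨(j : ℕ) + 1, hj⟩ else -∑ l : Fin n, u k l

theorem innerArgs_independent {m n N : ℕ+} (h : (N : ℕ) + 1 = m + n) (i : Fin m) :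
    AlgebraicIndependent k (innerArgs k h i) :=
  (algebraicIndependent_u k N).comp (innerPos h i) fun a b hab => by
    simp only [innerPos, Fin.mk.injEq] at hab
    exact Fin.ext (by omega)

theorem outerArgs_independent {m n N : ℕ+} (h : (N : ℕ) + 1 = m + n) (i : Fin m) :
    AlgebraicIndependent k (outerArgs k h i) := by
  classical
  have hinj : ∀ a b : Fin m, outerPos h i a = outerPos h i b → a = b := by
    intro a b hab
    have := n.pos
    simp only [outerPos, Fin.mk.injEq, Fin.le_def] at hab
    apply Fin.ext
    split_ifs at hab <;> omega
  let r : Fin N → MvPolynomial (Fin m) k := fun a =>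
    ∑ j : Fin m, if outerPos h i j = a then MvPolynomial.X j else 0
  have hr : ∀ j, r (outerPos h i j) = MvPolynomial.X j := by
    intro j
    simp only [r]
    rw [Finset.sum_eq_single j]
    · simp
    · intro b _ hb
      rw [if_neg fun hh => hb (hinj _ _ hh)]
    · simp
  have hz : ∀ l : Fin n, (l : ℕ) ≠ 0 → r (innerPos h i l) = 0 := by
    intro l hl
    refine Finset.sum_eq_zero fun j _ => if_neg fun hh => ?_
    have := l.isLt
    simp only [outerPos, innerPos, Fin.mk.injEq, Fin.le_def] at hh
    split_ifs at hh <;> omega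
  have h0 : r (innerPos h i ⟨0, n.pos⟩) = MvPolynomial.X i := by
    rw [← hr i]
    congr 1
    simp [innerPos, outerPos]
  let w : Fin m → MvPolynomial (Fin N) k := fun j =>
    if j = i then ∑ l : Fin n, MvPolynomial.X (innerPos h i l)
    else MvPolynomial.X (outerPos h i j)
  have hw : outerArgs k h i =
      fun j => algebraMap (MvPolynomial (Fin N) k) (Mould k N) (w j) := by
    funext j
    by_cases hj : j = i <;> simp [outerArgs, w, hj, u]
  rw [hw]
  refine algebraicIndependent_of_leftInverse k w r fun j => ?_
  by_cases hj : j = i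
  · subst hj
    simp only [w, if_true, map_sum, MvPolynomial.aeval_X]
    rw [Finset.sum_eq_single ⟨0, n.pos⟩]
    · exact h0
    · intro b _ hb
      exact hz b fun hb0 => hb (Fin.ext hb0)
    · simp
  · simp [w, hj, hr]

theorem cycleArgs_independent (n : ℕ) : AlgebraicIndependent k (cycleArgs k n) := by
  cases n with
  | zero => exact (algebraicIndependent_u k 0).comp _ (Function.injective_of_subsingleton id) |>
      fun h => by convert h
  | succ n =>
    let w : Fin (n + 1) → MvPolynomial (Fin (n + 1)) k := fun j =>
      if hj : (j : ℕ) + 1 < n + 1 then MvPolynomial.X ⟨(j : ℕ) + 1, hj⟩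
      else -∑ l : Fin (n + 1), MvPolynomial.X l
    have hw : cycleArgs k (n + 1) =
        fun j => algebraMap (MvPolynomial (Fin (n + 1)) k) (Mould k (n + 1)) (w j) := by
      funext j
      by_cases hj : (j : ℕ) + 1 < n + 1
      · simp only [cycleArgs, w, dif_pos hj, u]
      · simp only [cycleArgs, w, dif_neg hj, u, map_neg, map_sum]
    let r : Fin (n + 1) → MvPolynomial (Fin (n + 1)) k :=
      Fin.cons (-∑ l : Fin (n + 1), MvPolynomial.X l) fun j : Fin n => MvPolynomial.X j.castSucc
    rw [hw]
    refine algebraicIndependent_of_leftInverse k w r fun j => ?_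
    induction j using Fin.lastCases with
    | last =>
      have hl : ¬ ((Fin.last n : Fin (n + 1)) : ℕ) + 1 < n + 1 := by simp
      simp only [w, dif_neg hl, r, map_neg, map_sum, MvPolynomial.aeval_X]
      rw [Fin.sum_univ_succ]
      simp only [Fin.cons_zero, Fin.cons_succ]
      rw [Fin.sum_univ_castSucc]
      ring
    | cast j =>
      have hj : (j.castSucc : ℕ) + 1 < n + 1 := by simp
      simp only [w, dif_pos hj, MvPolynomial.aeval_X]
      exact Fin.cons_succ (α := fun _ => MvPolynomial (Fin (n + 1)) k) _ _ j

variable {k}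

/-- The partial composition of moulds,
`(f ∘_i g)(u_1, …, u_{m+n-1}) = (u_i + ⋯ + u_{i+n-1})
  f(u_1, …, u_{i-1}, u_i + ⋯ + u_{i+n-1}, u_{i+n}, …, u_{m+n-1}) g(u_i, …, u_{i+n-1})`.
The first factor comes from the derivative in `F_m[h^{(1)}, …, d/dt G_n[…], …]`. -/
noncomputable def comp {m n N : ℕ+} (h : (N : ℕ) + 1 = m + n) (i : Fin m)
    (f : Mould k m) (g : Mould k n) : Mould k N :=
  (∑ l : Fin n, u k (innerPos h i l)) *
    subst (outerArgs k h i) (outerArgs_independent k h i) f *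
    subst (innerArgs k h i) (innerArgs_independent k h i) g

/-- The action of permutations on moulds,
`(σ f)(u_1, …, u_n) = f(u_{σ(1)}, …, u_{σ(n)})`. -/
noncomputable def act {n : ℕ} (σ : Equiv.Perm (Fin n)) : Mould k n →ₐ[k] Mould k n :=
  subst (fun j => u k (σ j)) ((algebraicIndependent_u k n).comp σ σ.injective)

/-- The action of the `(n+1)`-cycle,
`(γ f)(u_1, …, u_n) = f(u_2, u_3, …, u_n, -u_1 - u_2 - ⋯ - u_n)`. -/
noncomputable def cycle (n : ℕ) : Mould k n →ₐ[k] Mould k n :=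
  subst (cycleArgs k n) (cycleArgs_independent k n)

variable (k)

/-- The permutational mould
`f_σ = 1 / (u_{σ(1)} (u_{σ(1)} + u_{σ(2)}) ⋯ (u_{σ(1)} + ⋯ + u_{σ(n)}))`. -/
noncomputable def perm {n : ℕ} (σ : Equiv.Perm (Fin n)) : Mould k n :=
  ∏ i : Fin n, (∑ j ∈ Finset.Iic i, u k (σ j))⁻¹

/-- The linear span of the permutational moulds `f_σ`, `σ ∈ S_n`. -/
noncomputable def permSpan (n : ℕ) : Submodule k (Mould k n) := Submodule.span k (Set.range (perm k))

end Mould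

/-- The operad of moulds; its unit is the mould `1 / u_1`. -/
noncomputable def mouldOperad : PreOperad.{u, u} k where
  Obj n := Mould k n
  one := (Mould.u k (n := (1 : ℕ+)) ⟨0, Nat.one_pos⟩)⁻¹
  comp h i f g := Mould.comp h i f g
  act σ f := Mould.act σ f

/-- The linear span of the permutational moulds, as a family of subspaces of the operad. -/
noncomputable def permutationalMoulds (n : ℕ+) : Submodule k ((mouldOperad k).Obj n) :=
  Mould.permSpan k n

end Mould

/-! ## Words and shuffles -/

/-- `w` belongs to the shuffle of the words `a` and `b`. -/
inductive IsShuffle {α : Type u} : List α → List α → List α → Prop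
  | nil : IsShuffle [] [] []
  | left {a b w : List α} (x : α) : IsShuffle a b w → IsShuffle (x :: a) b (x :: w)
  | right {a b w : List α} (x : α) : IsShuffle a b w → IsShuffle a (x :: b) (x :: w)

/-- The one-line notation `σ(1) σ(2) ⋯ σ(n)`, a word in the letters `1, …, n`. -/
def permWord {n : ℕ} (σ : Equiv.Perm (Fin n)) : List ℕ :=
  List.ofFn fun j => (σ j : ℕ) + 1

/-- The word `σ'(1) σ'(2) ⋯ σ'(n)` in the letters `1, …, n`, with `σ'(i) ≡ σ(i) + 1 mod n`. -/
def shiftedPermWord {n : ℕ} (σ : Equiv.Perm (Fin n)) : List ℕ :=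
  List.ofFn fun j => ((σ j : ℕ) + 1) % n + 1

/-! ## The Zinbiel operad

Its space of `n`-ary operations is the multilinear part of the free Zinbiel algebra on
`n` generators, and composition is substitution. -/

section Zinbiel

variable (k : Type u) [Field k] (X : Type v)

/-- The ideal of the free nonassociative algebra generated by the Zinbiel (dual Leibniz)
relations `(a b) c = a (b c) + a (c b)`. -/
noncomputable def zinbielIdeal : Submodule k (FreeNonUnitalNonAssocAlgebra k X) :=
  sInf {J | (∀ a b c, a * b * c - (a * (b * c) + a * (c * b)) ∈ J) ∧
    ∀ a x, x ∈ J → a * x ∈ J ∧ x * a ∈ J}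

theorem zinbielIdeal_mul_mem (a : FreeNonUnitalNonAssocAlgebra k X)
    {x : FreeNonUnitalNonAssocAlgebra k X} (hx : x ∈ zinbielIdeal k X) :
    a * x ∈ zinbielIdeal k X ∧ x * a ∈ zinbielIdeal k X := by
  simp only [zinbielIdeal, Submodule.mem_sInf] at hx ⊢
  exact ⟨fun J hJ => (hJ.2 a x (hx J hJ)).1, fun J hJ => (hJ.2 a x (hx J hJ)).2⟩

/-- The free Zinbiel algebra on the set `X`. -/
noncomputable def FreeZinbiel : Type (max u v) := FreeNonUnitalNonAssocAlgebra k X ⧸ zinbielIdeal k X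

namespace FreeZinbiel

noncomputable instance : AddCommGroup (FreeZinbiel k X) :=
  inferInstanceAs (AddCommGroup (FreeNonUnitalNonAssocAlgebra k X ⧸ zinbielIdeal k X))

noncomputable instance : Module k (FreeZinbiel k X) :=
  inferInstanceAs (Module k (FreeNonUnitalNonAssocAlgebra k X ⧸ zinbielIdeal k X))

/-- The quotient map from the free nonassociative algebra. -/
noncomputable def mk : FreeNonUnitalNonAssocAlgebra k X →ₗ[k] FreeZinbiel k X :=
  (zinbielIdeal k X).mkQ

theorem mk_surjective : Function.Surjective (mk k X) := (zinbielIdeal k X).mkQ_surjective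

theorem mk_eq_mk {a b : FreeNonUnitalNonAssocAlgebra k X} :
    mk k X a = mk k X b ↔ a - b ∈ zinbielIdeal k X :=
  Submodule.Quotient.eq _

noncomputable instance : Mul (FreeZinbiel k X) where
  mul := Quotient.map₂ (· * ·) fun a a' ha b b' hb => by
    have ha' := (Submodule.quotientRel_def _).mp ha
    have hb' := (Submodule.quotientRel_def _).mp hb
    refine (Submodule.quotientRel_def _).mpr ?_
    have : a * b - a' * b' = (a - a') * b + a' * (b - b') := by
      rw [sub_mul, mul_sub]; abel
    rw [this]
    exact add_mem (zinbielIdeal_mul_mem k X b ha').2 (zinbielIdeal_mul_mem k X a' hb').1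

theorem mk_mul (a b : FreeNonUnitalNonAssocAlgebra k X) :
    mk k X (a * b) = mk k X a * mk k X b := rfl

noncomputable instance : NonUnitalNonAssocRing (FreeZinbiel k X) where
  left_distrib a b c := by
    obtain ⟨a, rfl⟩ := mk_surjective k X a
    obtain ⟨b, rfl⟩ := mk_surjective k X b
    obtain ⟨c, rfl⟩ := mk_surjective k X c
    rw [← map_add, ← mk_mul, mul_add, map_add, mk_mul, mk_mul]
  right_distrib a b c := by
    obtain ⟨a, rfl⟩ := mk_surjective k X a
    obtain ⟨b, rfl⟩ := mk_surjective k X b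
    obtain ⟨c, rfl⟩ := mk_surjective k X c
    rw [← map_add, ← mk_mul, add_mul, map_add, mk_mul, mk_mul]
  zero_mul a := by
    obtain ⟨a, rfl⟩ := mk_surjective k X a
    rw [← map_zero (mk k X), ← mk_mul, zero_mul]
  mul_zero a := by
    obtain ⟨a, rfl⟩ := mk_surjective k X a
    rw [← map_zero (mk k X), ← mk_mul, mul_zero]

instance : IsScalarTower k (FreeZinbiel k X) (FreeZinbiel k X) where
  smul_assoc r a b := by
    obtain ⟨a, rfl⟩ := mk_surjective k X a
    obtain ⟨b, rfl⟩ := mk_surjective k X b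
    simp only [smul_eq_mul]
    rw [← map_smul, ← mk_mul, ← mk_mul, smul_mul_assoc, map_smul]

instance : SMulCommClass k (FreeZinbiel k X) (FreeZinbiel k X) where
  smul_comm r a b := by
    obtain ⟨a, rfl⟩ := mk_surjective k X a
    obtain ⟨b, rfl⟩ := mk_surjective k X b
    simp only [smul_eq_mul]
    rw [← map_smul, ← mk_mul, ← mk_mul, mul_smul_comm, map_smul]

theorem mul_mul_eq (a b c : FreeZinbiel k X) : a * b * c = a * (b * c) + a * (c * b) := by
  obtain ⟨a, rfl⟩ := mk_surjective k X a
  obtain ⟨b, rfl⟩ := mk_surjective k X b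
  obtain ⟨c, rfl⟩ := mk_surjective k X c
  simp only [← mk_mul, ← map_add]
  rw [mk_eq_mk]
  simp only [zinbielIdeal, Submodule.mem_sInf]
  exact fun J hJ => hJ.1 a b c

variable {X}

/-- The generators. -/
noncomputable def gen (x : X) : FreeZinbiel k X :=
  mk k X (FreeNonUnitalNonAssocAlgebra.of k x)

/-- The value of a nonassociative monomial. -/
noncomputable def monomial : FreeMagma X →ₙ* FreeZinbiel k X := FreeMagma.lift (gen k)

variable {k}

/-- Homomorphisms to Zinbiel algebras vanish on the ideal of relations. -/
theorem zinbielIdeal_le_ker {B : Type w} [NonUnitalNonAssocRing B] [Module k B]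
    (hB : ∀ a b c : B, a * b * c = a * (b * c) + a * (c * b))
    (F : FreeNonUnitalNonAssocAlgebra k X →ₙₐ[k] B) :
    zinbielIdeal k X ≤ LinearMap.ker (F : FreeNonUnitalNonAssocAlgebra k X →ₗ[k] B) := by
  refine sInf_le ⟨fun a b c => ?_, fun a x hx => ?_⟩
  · simp only [LinearMap.mem_ker]
    change F _ = 0
    rw [map_sub, map_add, map_mul, map_mul, map_mul, map_mul, map_mul, map_mul, hB, sub_self]
  · have hx' : F x = 0 := hx
    constructor
    · change F (a * x) = 0
      rw [map_mul, hx', mul_zero]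
    · change F (x * a) = 0
      rw [map_mul, hx', zero_mul]

/-- The substitution `f ↦ f(v)` of elements `v` for the generators: the homomorphism of Zinbiel
algebras that sends the generator `x` to `v x`. -/
noncomputable def subst {Y : Type w} (v : X → FreeZinbiel k Y) :
    FreeZinbiel k X →ₗ[k] FreeZinbiel k Y :=
  (zinbielIdeal k X).liftQ
    (FreeNonUnitalNonAssocAlgebra.lift k v :
      FreeNonUnitalNonAssocAlgebra k X →ₙₐ[k] FreeZinbiel k Y)
    (zinbielIdeal_le_ker (mul_mul_eq k Y) _)

theorem subst_mk {Y : Type w} (v : X → FreeZinbiel k Y) (a : FreeNonUnitalNonAssocAlgebra k X) :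
    subst v (mk k X a) = FreeNonUnitalNonAssocAlgebra.lift k v a := rfl

theorem subst_gen {Y : Type w} (v : X → FreeZinbiel k Y) (x : X) :
    subst v (gen k x) = v x := by
  rw [gen, subst_mk, FreeNonUnitalNonAssocAlgebra.lift_of_apply]

theorem subst_mul {Y : Type w} (v : X → FreeZinbiel k Y) (a b : FreeZinbiel k X) :
    subst v (a * b) = subst v a * subst v b := by
  obtain ⟨a, rfl⟩ := mk_surjective k X a
  obtain ⟨b, rfl⟩ := mk_surjective k X b
  rw [← mk_mul, subst_mk, subst_mk, subst_mk, map_mul]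

end FreeZinbiel

/-- The multiset of the generators that occur in a nonassociative monomial. -/
def FreeMagma.content {X : Type v} : FreeMagma X → Multiset X
  | FreeMagma.of x => {x}
  | FreeMagma.mul a b => a.content + b.content

namespace FreeZinbiel

variable {X}

/-- The multihomogeneous component of the free Zinbiel algebra spanned by the monomials in which
each generator occurs as many times as in the multiset `c`. -/
noncomputable def component (c : Multiset X) : Submodule k (FreeZinbiel k X) :=
  Submodule.span k (monomial k '' {t | t.content = c})

theorem gen_mem (x : X) : gen k x ∈ component k {x} :=
  Submodule.subset_span ⟨FreeMagma.of x, rfl, rfl⟩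

variable {k}

theorem mul_mem {c d : Multiset X} {a b : FreeZinbiel k X} (ha : a ∈ component k c)
    (hb : b ∈ component k d) : a * b ∈ component k (c + d) := by
  induction ha using Submodule.span_induction with
  | mem a ha =>
    obtain ⟨s, hs, rfl⟩ := ha
    induction hb using Submodule.span_induction with
    | mem b hb =>
      obtain ⟨t, ht, rfl⟩ := hb
      rw [← map_mul]
      refine Submodule.subset_span ⟨s * t, ?_, rfl⟩
      have hs' : s.content = c := hs
      have ht' : t.content = d := ht
      change s.content + t.content = c + d
      rw [hs', ht']
    | zero => rw [mul_zero]; exact zero_mem _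
    | add x y _ _ hx hy => rw [mul_add]; exact add_mem hx hy
    | smul r x _ hx => rw [mul_smul_comm]; exact Submodule.smul_mem _ _ hx
  | zero => rw [zero_mul]; exact zero_mem _
  | add x y _ _ hx hy => rw [add_mul]; exact add_mem hx hy
  | smul r x _ hx => rw [smul_mul_assoc]; exact Submodule.smul_mem _ _ hx

theorem subst_mem {Y : Type w} {v : X → FreeZinbiel k Y} {d : X → Multiset Y}
    (hv : ∀ x, v x ∈ component k (d x)) {c : Multiset X} {a : FreeZinbiel k X}
    (ha : a ∈ component k c) : subst v a ∈ component k (c.bind d) := by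
  induction ha using Submodule.span_induction with
  | mem a ha =>
    obtain ⟨t, ht, rfl⟩ := ha
    have ht' : t.content = c := ht
    subst ht'
    clear ht
    induction t using FreeMagma.recOnMul with
    | ih1 x =>
      change subst v (gen k x) ∈ component k (Multiset.bind {x} d)
      rw [subst_gen, Multiset.singleton_bind]
      exact hv x
    | ih2 s t hs ht =>
      change _ ∈ component k ((s.content + t.content).bind d)
      rw [map_mul, subst_mul, Multiset.add_bind]
      exact mul_mem hs ht
  | zero => rw [map_zero]; exact zero_mem _
  | add x y _ _ hx hy => rw [map_add]; exact add_mem hx hy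
  | smul r x _ hx => rw [map_smul]; exact Submodule.smul_mem _ _ hx

end FreeZinbiel

end Zinbiel

section ZinbielOperad

variable (k : Type u) [Field k]

/-- The space of `n`-ary operations of the Zinbiel operad: the multilinear elements of the free
Zinbiel algebra on `x_1, …, x_n`. -/
noncomputable def Zinbiel (n : ℕ) : Submodule k (FreeZinbiel k (Fin n)) :=
  FreeZinbiel.component k (Finset.univ : Finset (Fin n)).val

namespace Zinbiel

variable {k}

/-- The generators `x_1, …, x_{i-1}, g(x_i, …, x_{i+n-1}), x_{i+n}, …, x_{m+n-1}` that are
substituted in `f` in order to get `f ∘_i g`. -/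
noncomputable def compArgs {m n N : ℕ+} (h : (N : ℕ) + 1 = m + n) (i : Fin m)
    (g : FreeZinbiel k (Fin n)) (j : Fin m) : FreeZinbiel k (Fin N) :=
  if j = i then FreeZinbiel.subst (fun l => FreeZinbiel.gen k (innerPos h i l)) g
  else FreeZinbiel.gen k (outerPos h i j)

theorem subst_compArgs_mem {m n N : ℕ+} (h : (N : ℕ) + 1 = m + n) (i : Fin m)
    {f : FreeZinbiel k (Fin m)} {g : FreeZinbiel k (Fin n)} (hf : f ∈ Zinbiel k m)
    (hg : g ∈ Zinbiel k n) : FreeZinbiel.subst (compArgs h i g) f ∈ Zinbiel k N := by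
  let d : Fin m → Multiset (Fin N) := fun j =>
    if j = i then (Finset.univ : Finset (Fin n)).val.map (innerPos h i) else {outerPos h i j}
  have hd : ∀ j, compArgs h i g j ∈ FreeZinbiel.component k (d j) := by
    intro j
    by_cases hj : j = i
    · have := FreeZinbiel.subst_mem (d := fun l => {innerPos h i l})
        (fun l => FreeZinbiel.gen_mem k (innerPos h i l)) hg
      rw [Multiset.bind_singleton] at this
      simpa only [compArgs, d, if_pos hj] using this
    · simpa only [compArgs, d, if_neg hj] using FreeZinbiel.gen_mem k (outerPos h i j)
  have hbind : (Finset.univ : Finset (Fin m)).val.bind d = (Finset.univ : Finset (Fin N)).val := by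
    symm
    refine Multiset.eq_of_le_of_card_le ((Multiset.le_iff_subset Finset.univ.nodup).mpr ?_) ?_
    · intro a _
      rw [Multiset.mem_bind]
      have ha := a.isLt
      have hi := i.isLt
      have hn := n.pos
      by_cases h1 : (a : ℕ) < i
      · refine ⟨⟨a, by omega⟩, Finset.mem_val.mpr (Finset.mem_univ _), ?_⟩
        have hne : (⟨a, by omega⟩ : Fin m) ≠ i := fun hh => by
          rw [Fin.ext_iff] at hh; simp only at hh; omega
        simp only [d, if_neg hne, Multiset.mem_singleton]
        apply Fin.ext
        simp only [outerPos, Fin.le_def]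
        rw [if_pos h1.le]
      · by_cases h2 : (a : ℕ) < i + n
        · refine ⟨i, Finset.mem_val.mpr (Finset.mem_univ _), ?_⟩
          simp only [d, if_true, Multiset.mem_map]
          refine ⟨⟨a - i, by omega⟩, Finset.mem_val.mpr (Finset.mem_univ _), ?_⟩
          simp only [innerPos, Fin.ext_iff]
          omega
        · refine ⟨⟨a + 1 - n, by omega⟩, Finset.mem_val.mpr (Finset.mem_univ _), ?_⟩
          have hne : (⟨a + 1 - n, by omega⟩ : Fin m) ≠ i := fun hh => by
            rw [Fin.ext_iff] at hh; simp only at hh; omega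
          simp only [d, if_neg hne, Multiset.mem_singleton]
          apply Fin.ext
          simp only [outerPos, Fin.le_def]
          rw [if_neg (by omega)]
          omega
    · rw [Multiset.card_bind]
      have hsum : (Multiset.map (Multiset.card ∘ d) (Finset.univ : Finset (Fin m)).val).sum =
          ∑ j : Fin m, Multiset.card (d j) := rfl
      have hc : ∀ j : Fin m, Multiset.card (d j) = 1 + if j = i then (n : ℕ) - 1 else 0 := by
        intro j
        have := n.pos
        by_cases hj : j = i
        · simp only [d, if_pos hj, Multiset.card_map, Finset.card_val, Finset.card_univ,
            Fintype.card_fin]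
          omega
        · simp only [d, if_neg hj, Multiset.card_singleton]
      rw [hsum, Finset.sum_congr rfl fun j _ => hc j, Finset.sum_add_distrib]
      simp only [Finset.sum_const, Finset.card_univ, Fintype.card_fin, smul_eq_mul, mul_one,
        Finset.sum_ite_eq', Finset.mem_univ, if_true, Finset.card_val]
      have := n.pos
      omega
  have := FreeZinbiel.subst_mem hd hf
  rwa [hbind] at this

theorem subst_perm_mem {n : ℕ} (σ : Equiv.Perm (Fin n)) {f : FreeZinbiel k (Fin n)}
    (hf : f ∈ Zinbiel k n) :
    FreeZinbiel.subst (fun j => FreeZinbiel.gen k (σ j)) f ∈ Zinbiel k n := by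
  have := FreeZinbiel.subst_mem (d := fun j => {σ j})
    (fun j => FreeZinbiel.gen_mem k (σ j)) hf
  rw [Multiset.bind_singleton] at this
  have h2 : (Finset.univ : Finset (Fin n)).val.map σ = (Finset.univ : Finset (Fin n)).val := by
    conv_rhs => rw [← Finset.map_univ_equiv σ]
    rfl
  rwa [h2] at this

variable (k)

/-- The element `x_{w(1)} (x_{w(2)} (⋯ x_{w(n)}))` of the free Zinbiel algebra, for a nonempty
word `w`. -/
noncomputable def wordMonomial {X : Type v} : List X → FreeZinbiel k X
  | [] => 0
  | [x] => FreeZinbiel.gen k x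
  | x :: y :: w => FreeZinbiel.gen k x * wordMonomial (y :: w)

theorem wordMonomial_mem {X : Type v} : ∀ (w : List X), w ≠ [] →
    wordMonomial k w ∈ FreeZinbiel.component k (w : Multiset X)
  | [], h => absurd rfl h
  | [x], _ => FreeZinbiel.gen_mem k x
  | x :: y :: w, _ => by
    have := FreeZinbiel.mul_mem (FreeZinbiel.gen_mem k x)
      (wordMonomial_mem (y :: w) (List.cons_ne_nil _ _))
    exact this

/-- The basis element of the Zinbiel operad indexed by the permutation `σ`: the operation
`x_{σ(1)} (x_{σ(2)} (⋯ x_{σ(n)}))`, which is the word `x_{σ(1)} x_{σ(2)} ⋯ x_{σ(n)}` of the free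
Zinbiel algebra realized on words. -/
noncomputable def ofPerm {n : ℕ+} (σ : Equiv.Perm (Fin n)) : Zinbiel k n :=
  ⟨wordMonomial k (List.ofFn σ), by
    have h0 : List.ofFn σ ≠ [] := fun h => n.pos.ne' (by simpa using congrArg List.length h)
    have h1 : ((List.ofFn σ : List (Fin n)) : Multiset (Fin n)) =
        (Finset.univ : Finset (Fin n)).val := by
      symm
      refine Multiset.eq_of_le_of_card_le ((Multiset.le_iff_subset Finset.univ.nodup).mpr ?_) ?_
      · intro a _
        rw [Multiset.mem_coe, List.mem_ofFn]
        exact σ.surjective a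
      · simp
    have := wordMonomial_mem k (List.ofFn σ) h0
    rwa [h1] at this⟩

end Zinbiel

/-- The Zinbiel operad. -/
noncomputable def zinbielOperad : PreOperad.{u, u} k where
  Obj n := Zinbiel k n
  one := ⟨FreeZinbiel.gen k ⟨0, Nat.one_pos⟩, FreeZinbiel.gen_mem k _⟩
  comp h i f g := ⟨FreeZinbiel.subst (Zinbiel.compArgs h i g) f,
    Zinbiel.subst_compArgs_mem h i f.2 g.2⟩
  act σ f := ⟨FreeZinbiel.subst (fun j => FreeZinbiel.gen k (σ j)) f,
    Zinbiel.subst_perm_mem σ f.2⟩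

end ZinbielOperad

/-!
Up to the factor `u_i + ⋯ + u_{i+n-1}` in `f ∘_i g`, all the operations on moulds are substitutions
of linear forms. In the partial sums `P_a = u_1 + ⋯ + u_a` these substitutions only
shift indices: the arguments of `f` in `f ∘_i g` send `P_a` to `P_a` or `P_{a+n-1}`, those of `g`
send `P_a` to `P_{i+a} - P_i` (with `i` counted from `0`), and the cycle sends `P_a` to
`P_{a+1} - P_1` for `a < n` and `P_n` to `-P_1`. As homomorphisms on moulds may be compared on the
`P_a` (`Mould.hom_ext_psum`), the axioms of an anticyclic operad become identities between indices.
The action of `S_{n+1}` permutes the variables `u_1, …, u_n` and `u_{n+1} = -u_1 - ⋯ - u_n`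
(`Mould.extRep`).

The mould `f_σ` is the product of the inverses of the partial sums of a word (`prefixProd`). Such
products satisfy the shuffle identity `f_a f_b = ∑_{w ∈ a ⧢ b} f_w` (`prefixProd_mul`), which
follows from `1/(pq) = 1/(p+q) (1/p + 1/q)` by removing last letters. In `f_Id ∘_i f_Id` the factor
`u_i + ⋯ + u_{i+n-1}` cancels the last factor of `f_{Id_n}`, and what is left is a product of this
form, followed by the partial sums common to all the words of the shuffle. In `γ f_σ` the partial
sums after the letter `1` of the word `a 1 w` are those of the word `1 w̄` up to sign
(`prefixProd_neg`), so `γ f_σ` is again a product of two such functions up to sign.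

The comparison with the Zinbiel operad does not use a composition formula. Functions on finite sets
of variables with the product `a ≺ b = D⁻¹ (D(a) b)`, where `D` multiplies by the sum of the
variables, form a Zinbiel algebra (`HalfShuffleAlgebra`), because `(a ≺ b) ≺ c = D⁻¹ (D(a) b c)`.
The homomorphism from the free Zinbiel algebra that sends the generator `c` to `1 / u_c` sends a
nonassociative monomial `t` to an explicit rational function `FreeMagma.ratio`, which behaves under
substitution exactly as the composition of moulds prescribes (`FreeMagma.ratio_lift`), and it sends
a word to the product of the inverses of the partial sums of the mirror word. So it gives a map of
operads from the Zinbiel operad to moulds. Its image is the span of the permutational moulds because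
the free Zinbiel algebra is spanned by words, and this span is therefore a suboperad. The map is
injective because the `f_σ` are linearly independent (`Mould.linearIndependent_perm`): under
`u_j = t ^ j` the mould `f_Id` strictly dominates all the other `f_σ` as `t → ∞`, and the symmetric
group permutes the `f_σ` transitively.
-/

/-! ### Substitutions and partial sums of the variables -/

namespace Mould

section Substitution

variable {k : Type u} [Field k]

@[simp]
theorem subst_u {m N : ℕ} (v : Fin m → Mould k N) (hv : AlgebraicIndependent k v) (j : Fin m) :
    subst v hv (u k j) = v j := by
  have hv' : Function.Injective (MvPolynomial.aeval v : MvPolynomial (Fin m) k →ₐ[k] Mould k N) :=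
    hv
  change IsFractionRing.liftAlgHom hv' (algebraMap _ _ (MvPolynomial.X j)) = v j
  rw [IsFractionRing.liftAlgHom_apply, IsFractionRing.lift_algebraMap]
  exact MvPolynomial.aeval_X v j

theorem hom_ext {m : ℕ} {K : Type v} [Field K] [Algebra k K] {φ ψ : Mould k m →ₐ[k] K}
    (h : ∀ j, φ (u k j) = ψ (u k j)) : φ = ψ := by
  refine IsLocalization.algHom_ext (nonZeroDivisors (MvPolynomial (Fin m) k)) ?_
  exact MvPolynomial.algHom_ext h

variable (k) in
/-- The sum `u_1 + ⋯ + u_a` of the first `a` variables. The sum stops at `u_n` when `n < a`. -/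
noncomputable def psum (n a : ℕ) : Mould k n :=
  ∑ b ∈ Finset.range a, if hb : b < n then u k ⟨b, hb⟩ else 0

theorem psum_zero (n : ℕ) : psum k n 0 = 0 := rfl

theorem psum_succ {n a : ℕ} (ha : a < n) : psum k n (a + 1) = psum k n a + u k ⟨a, ha⟩ := by
  rw [psum, Finset.sum_range_succ, dif_pos ha]; rfl

theorem u_eq_psum {n : ℕ} (j : Fin n) : u k j = psum k n (j + 1) - psum k n j := by
  rw [psum_succ j.isLt]; simp

theorem sum_u_eq_psum (n : ℕ) : ∑ l : Fin n, u k l = psum k n n := by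
  rw [psum, ← Fin.sum_univ_eq_sum_range (fun b => if hb : b < n then u k ⟨b, hb⟩ else 0)]
  simp

/-- Homomorphisms on moulds may be compared on the partial sums `u_1 + ⋯ + u_a`. -/
theorem hom_ext_psum {m : ℕ} {K : Type v} [Field K] [Algebra k K] {φ ψ : Mould k m →ₐ[k] K}
    (h : ∀ a, a ≤ m → φ (psum k m a) = ψ (psum k m a)) : φ = ψ :=
  hom_ext fun j => by rw [u_eq_psum, map_sub, map_sub, h _ j.isLt, h _ j.isLt.le]

theorem sum_u_innerPos {m n N : ℕ+} (h : (N : ℕ) + 1 = m + n) (i : Fin m) :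
    ∑ l : Fin n, u k (innerPos h i l) = psum k N (i + n) - psum k N i := by
  have key : ∀ a : ℕ, a ≤ n → ∑ b ∈ Finset.range a,
      (if hb : (i : ℕ) + b < N then u k (⟨i + b, hb⟩ : Fin N) else 0) =
        psum k N (i + a) - psum k N i := by
    intro a ha
    induction a with
    | zero => simp
    | succ a ih =>
      have hi := i.isLt
      have hlt : (i : ℕ) + a < N := by omega
      rw [Finset.sum_range_succ, ih (by omega), dif_pos hlt, ← add_assoc, psum_succ hlt]
      ring
  rw [← key n le_rfl, ← Fin.sum_univ_eq_sum_range
    (fun b => if hb : (i : ℕ) + b < N then u k (⟨i + b, hb⟩ : Fin N) else 0)]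
  refine Finset.sum_congr rfl fun l _ => ?_
  have hl : (i : ℕ) + l < N := (innerPos h i l).isLt
  rw [dif_pos hl]
  rfl

theorem inner_psum {m n N : ℕ+} (h : (N : ℕ) + 1 = m + n) (i : Fin m) {a : ℕ} (ha : a ≤ n) :
    subst (innerArgs k h i) (innerArgs_independent k h i) (psum k n a) =
      psum k N (i + a) - psum k N i := by
  induction a with
  | zero => simp [psum_zero]
  | succ a ih =>
    have hi := i.isLt
    have hlt : (i : ℕ) + a < N := by omega
    rw [psum_succ (show a < (n : ℕ) by omega), map_add, ih (by omega), subst_u, innerArgs,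
      ← add_assoc, psum_succ hlt]
    simp only [innerPos]
    ring

theorem outer_psum {m n N : ℕ+} (h : (N : ℕ) + 1 = m + n) (i : Fin m) {a : ℕ} (ha : a ≤ m) :
    subst (outerArgs k h i) (outerArgs_independent k h i) (psum k m a) =
      psum k N (if a ≤ i then a else a + n - 1) := by
  have hn := n.pos
  induction a with
  | zero => simp [psum_zero]
  | succ a ih =>
    rw [psum_succ (show a < (m : ℕ) by omega), map_add, ih (by omega), subst_u, outerArgs]
    rcases lt_trichotomy a (i : ℕ) with hlt | heq | hgt
    · have hne : (⟨a, by omega⟩ : Fin m) ≠ i := fun hh => hlt.ne (congrArg Fin.val hh)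
      rw [if_neg hne, if_pos hlt.le, if_pos (by omega),
        psum_succ (show a < (N : ℕ) by have := i.isLt; omega)]
      simp [outerPos, Fin.le_def, hlt.le]
    · rw [if_pos (Fin.ext heq), if_pos heq.le, if_neg (by omega), sum_u_innerPos, heq,
        show (i : ℕ) + 1 + n - 1 = i + n by omega]
      ring
    · have hne : (⟨a, by omega⟩ : Fin m) ≠ i := fun hh => hgt.ne' (congrArg Fin.val hh)
      rw [if_neg hne, if_neg (by omega), if_neg (by omega),
        show a + 1 + (n : ℕ) - 1 = (a + n - 1) + 1 by omega,
        psum_succ (show a + (n : ℕ) - 1 < (N : ℕ) by omega)]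
      simp [outerPos, Fin.le_def, hgt.not_ge]

theorem cycle_psum {n a : ℕ} (ha : a < n) :
    cycle n (psum k n a) = psum k n (a + 1) - psum k n 1 := by
  induction a with
  | zero => simp [psum_zero]
  | succ a ih =>
    rw [psum_succ (by omega : a < n), map_add, ih (by omega), cycle, subst_u, cycleArgs,
      dif_pos ha, psum_succ ha]
    ring

theorem cycle_psum_self {n : ℕ} (hn : 0 < n) : cycle n (psum k n n) = -psum k n 1 := by
  obtain ⟨n, rfl⟩ := Nat.exists_eq_succ_of_ne_zero hn.ne'
  rw [psum_succ (Nat.lt_succ_self n), map_add, cycle_psum (Nat.lt_succ_self n), cycle, subst_u,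
    cycleArgs, dif_neg (by simp), sum_u_eq_psum]
  ring

theorem comp_eq {m n N : ℕ+} (h : (N : ℕ) + 1 = m + n) (i : Fin m) (f : Mould k m)
    (g : Mould k n) : comp h i f g = (psum k N (i + n) - psum k N i) *
      subst (outerArgs k h i) (outerArgs_independent k h i) f *
      subst (innerArgs k h i) (innerArgs_independent k h i) g := by
  rw [comp, sum_u_innerPos]

theorem sum_ne_zero {ι K : Type*} [Field K] [Algebra k K] {v : ι → K}
    (hv : AlgebraicIndependent k v) {E : Finset ι} (hE : E.Nonempty) : ∑ j ∈ E, v j ≠ 0 := by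
  intro h0
  obtain ⟨j, hj⟩ := hE
  have := linearIndependent_iff'.mp hv.linearIndependent E (fun _ => 1) (by simpa using h0) j hj
  exact one_ne_zero this

theorem u_ne_zero {n : ℕ} (j : Fin n) : u k j ≠ 0 := by
  simpa using sum_ne_zero (algebraicIndependent_u k n) (Finset.singleton_nonempty j)

@[simp]
theorem act_u {n : ℕ} (σ : Equiv.Perm (Fin n)) (j : Fin n) : act σ (u k j) = u k (σ j) :=
  subst_u _ _ j

end Substitution

/-! ### The operad axioms for moulds -/

section Operad

variable {k : Type u} [Field k]

theorem comp_one {m : ℕ+} (h : (m : ℕ) + 1 = m + (1 : ℕ+)) (i : Fin m) (f : Mould k m) :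
    comp h i f (u k (n := (1 : ℕ+)) ⟨0, Nat.one_pos⟩)⁻¹ = f := by
  have houter : subst (outerArgs k h i) (outerArgs_independent k h i) = AlgHom.id k _ := by
    refine hom_ext_psum fun a ha => ?_
    rw [outer_psum h i ha, AlgHom.id_apply, PNat.one_coe]
    split_ifs <;> rfl
  have hsum : psum k m (i + (1 : ℕ+)) - psum k m i = u k i := (u_eq_psum i).symm
  rw [comp_eq, houter, map_inv₀, subst_u, innerArgs, hsum, AlgHom.id_apply]
  have hpos : innerPos h i ⟨0, Nat.one_pos⟩ = i := rfl
  rw [hpos]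
  field_simp [u_ne_zero i]

theorem one_comp {n : ℕ+} (h : (n : ℕ) + 1 = (1 : ℕ+) + n) (i : Fin (1 : ℕ+)) (g : Mould k n) :
    comp h i (u k (n := (1 : ℕ+)) ⟨0, Nat.one_pos⟩)⁻¹ g = g := by
  have hi : (i : ℕ) = 0 := by have := i.isLt; simp only [PNat.one_coe] at this; omega
  have hinner : subst (innerArgs k h i) (innerArgs_independent k h i) = AlgHom.id k _ := by
    refine hom_ext_psum fun a ha => ?_
    rw [inner_psum h i ha, AlgHom.id_apply, hi, psum_zero, zero_add, sub_zero]
  have h0 : (⟨0, Nat.one_pos⟩ : Fin (1 : ℕ+)) = i := Fin.ext hi.symm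
  have hne : ∑ l : Fin n, u k (innerPos h i l) ≠ 0 := by
    refine sum_ne_zero ((algebraicIndependent_u k n).comp _ fun a b hab => ?_)
      ⟨⟨0, n.pos⟩, Finset.mem_univ _⟩
    simpa [innerPos, Fin.ext_iff] using hab
  rw [comp, hinner, map_inv₀, subst_u, outerArgs, if_pos h0, AlgHom.id_apply,
    mul_inv_cancel₀ hne, one_mul]

theorem comp_assoc {l m n M L N : ℕ+} (h₁ : (M : ℕ) + 1 = l + m) (h₂ : (N : ℕ) + 1 = M + n)
    (h₃ : (L : ℕ) + 1 = m + n) (h₄ : (N : ℕ) + 1 = l + L) (i : Fin l) (j : Fin m)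
    (f : Mould k l) (g : Mould k m) (e : Mould k n) :
    comp h₂ (innerPos h₁ i j) (comp h₁ i f g) e = comp h₄ i f (comp h₃ j g e) := by
  have hi := i.isLt
  have hj := j.isLt
  have hm := m.pos
  have hn := n.pos
  have hij : ((innerPos h₁ i j : Fin M) : ℕ) = i + j := rfl
  have hf : (subst (outerArgs k h₂ (innerPos h₁ i j)) (outerArgs_independent k _ _)).comp
      (subst (outerArgs k h₁ i) (outerArgs_independent k _ _)) =
      subst (outerArgs k h₄ i) (outerArgs_independent k _ _) := by
    refine hom_ext_psum fun a ha => ?_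
    rw [AlgHom.comp_apply, outer_psum h₁ i ha, outer_psum h₄ i ha,
      outer_psum h₂ _ (by split_ifs <;> omega), hij]
    congr 1
    split_ifs <;> omega
  have hg : (subst (outerArgs k h₂ (innerPos h₁ i j)) (outerArgs_independent k _ _)).comp
      (subst (innerArgs k h₁ i) (innerArgs_independent k _ _)) =
      (subst (innerArgs k h₄ i) (innerArgs_independent k _ _)).comp
      (subst (outerArgs k h₃ j) (outerArgs_independent k _ _)) := by
    refine hom_ext_psum fun a ha => ?_
    rw [AlgHom.comp_apply, AlgHom.comp_apply, inner_psum h₁ i ha, map_sub,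
      outer_psum h₂ _ (by omega), outer_psum h₂ _ (by omega), outer_psum h₃ j ha,
      inner_psum h₄ i (by split_ifs <;> omega), hij]
    congr 2 <;> split_ifs <;> omega
  have he : subst (innerArgs k h₂ (innerPos h₁ i j)) (innerArgs_independent k _ _) =
      (subst (innerArgs k h₄ i) (innerArgs_independent k _ _)).comp
      (subst (innerArgs k h₃ j) (innerArgs_independent k _ _)) := by
    refine hom_ext_psum fun a ha => ?_
    rw [AlgHom.comp_apply, inner_psum h₂ _ ha, inner_psum h₃ j ha, map_sub,
      inner_psum h₄ i (by omega), inner_psum h₄ i (by omega), hij, add_assoc]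
    ring
  simp only [comp_eq, map_mul, map_sub]
  have hf' := DFunLike.congr_fun hf f
  have hg' := DFunLike.congr_fun hg g
  have he' := DFunLike.congr_fun he e
  simp only [AlgHom.comp_apply] at hf' hg' he'
  rw [hf', hg', he', outer_psum h₂ _ (by omega), outer_psum h₂ _ (by omega),
    inner_psum h₄ i (by omega), inner_psum h₄ i (by omega), hij, if_neg (by omega),
    if_pos (by omega), show (i : ℕ) + m + n - 1 = i + L by omega, add_assoc]
  ring

theorem comp_comm {l m n M L N : ℕ+} (h₁ : (M : ℕ) + 1 = l + m) (h₂ : (N : ℕ) + 1 = M + n)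
    (h₃ : (L : ℕ) + 1 = l + n) (h₄ : (N : ℕ) + 1 = L + m) (i j : Fin l) (hij : i < j)
    (f : Mould k l) (g : Mould k m) (e : Mould k n) :
    comp h₂ (outerPos h₁ i j) (comp h₁ i f g) e =
      comp h₄ (outerPos h₃ j i) (comp h₃ j f e) g := by
  have hj := j.isLt
  have hlt : (i : ℕ) < j := hij
  have hm := m.pos
  have hn := n.pos
  have hp : ((outerPos h₁ i j : Fin M) : ℕ) = j + m - 1 := by
    simp [outerPos, Fin.le_def, hlt.not_ge]
  have hq : ((outerPos h₃ j i : Fin L) : ℕ) = i := by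
    simp [outerPos, Fin.le_def, hlt.le]
  have hf : (subst (outerArgs k h₂ (outerPos h₁ i j)) (outerArgs_independent k _ _)).comp
      (subst (outerArgs k h₁ i) (outerArgs_independent k _ _)) =
      (subst (outerArgs k h₄ (outerPos h₃ j i)) (outerArgs_independent k _ _)).comp
      (subst (outerArgs k h₃ j) (outerArgs_independent k _ _)) := by
    refine hom_ext_psum fun a ha => ?_
    rw [AlgHom.comp_apply, AlgHom.comp_apply, outer_psum h₁ i ha, outer_psum h₃ j ha,
      outer_psum h₂ _ (by split_ifs <;> omega), outer_psum h₄ _ (by split_ifs <;> omega), hp, hq]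
    congr 1
    split_ifs <;> omega
  have hg : (subst (outerArgs k h₂ (outerPos h₁ i j)) (outerArgs_independent k _ _)).comp
      (subst (innerArgs k h₁ i) (innerArgs_independent k _ _)) =
      subst (innerArgs k h₄ (outerPos h₃ j i)) (innerArgs_independent k _ _) := by
    refine hom_ext_psum fun a ha => ?_
    rw [AlgHom.comp_apply, inner_psum h₁ i ha, map_sub, outer_psum h₂ _ (by omega),
      outer_psum h₂ _ (by omega), inner_psum h₄ _ ha, hp, hq, if_pos (by omega),
      if_pos (by omega)]
  have he : subst (innerArgs k h₂ (outerPos h₁ i j)) (innerArgs_independent k _ _) =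
      (subst (outerArgs k h₄ (outerPos h₃ j i)) (outerArgs_independent k _ _)).comp
      (subst (innerArgs k h₃ j) (innerArgs_independent k _ _)) := by
    refine hom_ext_psum fun a ha => ?_
    rw [AlgHom.comp_apply, inner_psum h₂ _ ha, inner_psum h₃ j ha, map_sub,
      outer_psum h₄ _ (by omega), outer_psum h₄ _ (by omega), hp, hq]
    congr 2 <;> split_ifs <;> omega
  have hf' := DFunLike.congr_fun hf f
  have hg' := DFunLike.congr_fun hg g
  have he' := DFunLike.congr_fun he e
  simp only [AlgHom.comp_apply] at hf' hg' he'
  simp only [comp_eq, map_mul, map_sub]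
  rw [hf', hg', he', outer_psum h₂ _ (by omega), outer_psum h₂ _ (by omega),
    outer_psum h₄ _ (by omega), outer_psum h₄ _ (by omega), hp, hq, if_pos (by omega),
    if_pos (by omega), if_neg (by omega), if_neg (by omega),
    show (j : ℕ) + n + m - 1 = j + m - 1 + n by omega]
  ring

theorem comp_act {m n N : ℕ+} (h : (N : ℕ) + 1 = m + n) (i : Fin m) (σ : Equiv.Perm (Fin m))
    (τ : Equiv.Perm (Fin n)) (ρ : Equiv.Perm (Fin N))
    (hσ : ∀ j, j ≠ i → ρ (outerPos h i j) = outerPos h (σ i) (σ j))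
    (hτ : ∀ j, ρ (innerPos h i j) = innerPos h (σ i) (τ j)) (f : Mould k m) (g : Mould k n) :
    comp h (σ i) (act σ f) (act τ g) = act ρ (comp h i f g) := by
  have hsum : act ρ (∑ l : Fin n, u k (innerPos h i l)) =
      ∑ l : Fin n, u k (innerPos h (σ i) l) := by
    simp only [map_sum, act_u, hτ]
    exact Equiv.sum_comp τ fun l => u k (innerPos h (σ i) l)
  have hf : (subst (outerArgs k h (σ i)) (outerArgs_independent k _ _)).comp (act σ) =
      (act ρ).comp (subst (outerArgs k h i) (outerArgs_independent k _ _)) := by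
    refine hom_ext fun j => ?_
    rw [AlgHom.comp_apply, AlgHom.comp_apply, act_u, subst_u, subst_u, outerArgs, outerArgs]
    by_cases hj : j = i
    · rw [if_pos (congrArg σ hj), if_pos hj, hsum]
    · rw [if_neg fun hh => hj (σ.injective hh), if_neg hj, act_u, hσ j hj]
  have hg : (subst (innerArgs k h (σ i)) (innerArgs_independent k _ _)).comp (act τ) =
      (act ρ).comp (subst (innerArgs k h i) (innerArgs_independent k _ _)) := by
    refine hom_ext fun j => ?_
    rw [AlgHom.comp_apply, AlgHom.comp_apply, act_u, subst_u, subst_u, innerArgs, innerArgs,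
      act_u, hτ]
  have hf' := DFunLike.congr_fun hf f
  have hg' := DFunLike.congr_fun hg g
  simp only [AlgHom.comp_apply] at hf' hg'
  rw [comp, comp, map_mul, map_mul, hsum, hf', hg']

theorem cycle_comp {m n N : ℕ+} (h : (N : ℕ) + 1 = m + n) (i : Fin m) (hi : (i : ℕ) + 1 < m)
    (f : Mould k m) (g : Mould k n) :
    cycle N (comp h i f g) = comp h ⟨(i : ℕ) + 1, hi⟩ (cycle m f) g := by
  have hn := n.pos
  have hf : (cycle N).comp (subst (outerArgs k h i) (outerArgs_independent k _ _)) =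
      (subst (outerArgs k h ⟨(i : ℕ) + 1, hi⟩) (outerArgs_independent k _ _)).comp
        (cycle (k := k) m) := by
    refine hom_ext_psum fun a ha => ?_
    rw [AlgHom.comp_apply, AlgHom.comp_apply, outer_psum h i ha]
    rcases ha.lt_or_eq with hlt | rfl
    · rw [cycle_psum (by split_ifs <;> omega), cycle_psum hlt, map_sub, outer_psum h _ hlt,
        outer_psum h _ (by omega), if_pos (show 1 ≤ (i : ℕ) + 1 by omega)]
      congr 2
      dsimp only
      split_ifs <;> omega
    · rw [if_neg (by omega), show (m : ℕ) + n - 1 = N by omega, cycle_psum_self N.pos,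
        cycle_psum_self m.pos, map_neg, outer_psum h _ (by omega),
        if_pos (show 1 ≤ (i : ℕ) + 1 by omega)]
  have hg : (cycle N).comp (subst (innerArgs k h i) (innerArgs_independent k _ _)) =
      subst (innerArgs k h ⟨(i : ℕ) + 1, hi⟩) (innerArgs_independent k _ _) := by
    refine hom_ext_psum fun a ha => ?_
    rw [AlgHom.comp_apply, inner_psum h i ha, map_sub, cycle_psum (by omega),
      cycle_psum (by omega), inner_psum h _ ha, show (i : ℕ) + 1 + a = i + a + 1 by omega]
    ring
  have hf' := DFunLike.congr_fun hf f
  have hg' := DFunLike.congr_fun hg g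
  simp only [AlgHom.comp_apply] at hf' hg'
  rw [comp_eq, comp_eq, map_mul, map_mul, hf', hg', map_sub, cycle_psum (by omega),
    cycle_psum (by omega), show (i : ℕ) + 1 + n = i + n + 1 by omega]
  ring

theorem cycle_comp_last {m n N : ℕ+} (h : (N : ℕ) + 1 = m + n) (h' : (N : ℕ) + 1 = n + m)
    (i : Fin m) (hi : (i : ℕ) + 1 = m) (f : Mould k m) (g : Mould k n) :
    cycle N (comp h i f g) = -comp h' ⟨0, n.pos⟩ (cycle n g) (cycle m f) := by
  have hn := n.pos
  have hm := m.pos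
  have hf : (cycle N).comp (subst (outerArgs k h i) (outerArgs_independent k _ _)) =
      (subst (innerArgs k h' ⟨0, n.pos⟩) (innerArgs_independent k _ _)).comp
        (cycle (k := k) m) := by
    refine hom_ext_psum fun a ha => ?_
    rw [AlgHom.comp_apply, AlgHom.comp_apply, outer_psum h i ha]
    rcases ha.lt_or_eq with hlt | rfl
    · rw [if_pos (by omega), cycle_psum (by omega), cycle_psum hlt, map_sub, inner_psum h' _ hlt,
        inner_psum h' _ (by omega)]
      simp only [psum_zero, zero_add, sub_zero]
    · rw [if_neg (by omega), show (m : ℕ) + n - 1 = N by omega, cycle_psum_self N.pos,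
        cycle_psum_self m.pos, map_neg, inner_psum h' _ (by omega)]
      simp only [psum_zero, zero_add, sub_zero]
  have hg : (cycle N).comp (subst (innerArgs k h i) (innerArgs_independent k _ _)) =
      (subst (outerArgs k h' ⟨0, n.pos⟩) (outerArgs_independent k _ _)).comp
        (cycle (k := k) n) := by
    refine hom_ext_psum fun a ha => ?_
    rw [AlgHom.comp_apply, AlgHom.comp_apply, inner_psum h i ha, map_sub,
      cycle_psum (show (i : ℕ) < N by omega)]
    rcases ha.lt_or_eq with hlt | rfl
    · rw [cycle_psum (by omega), cycle_psum hlt, map_sub, outer_psum h' _ hlt,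
        outer_psum h' _ (by omega), if_neg (by simp), if_neg (by simp),
        show a + 1 + (m : ℕ) - 1 = i + a + 1 by omega, show 1 + (m : ℕ) - 1 = i + 1 by omega]
      ring
    · rw [show (i : ℕ) + n = N by omega, cycle_psum_self N.pos, cycle_psum_self n.pos, map_neg,
        outer_psum h' _ (by omega), if_neg (by simp), show 1 + (m : ℕ) - 1 = i + 1 by omega]
      ring
  have hf' := DFunLike.congr_fun hf f
  have hg' := DFunLike.congr_fun hg g
  simp only [AlgHom.comp_apply] at hf' hg'
  rw [comp_eq, comp_eq, map_mul, map_mul, hf', hg', map_sub, show (i : ℕ) + n = N by omega,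
    cycle_psum_self N.pos, cycle_psum (show (i : ℕ) < N by omega), hi]
  simp only [psum_zero, zero_add]
  ring

end Operad

end Mould

/-! ### The action of the symmetric group on `n + 1` points -/

namespace Mould

section CyclicAction

variable {k : Type u} [Field k]

theorem act_one {n : ℕ} (f : Mould k n) : act 1 f = f := by
  have : act (k := k) (1 : Equiv.Perm (Fin n)) = AlgHom.id k _ := hom_ext fun j => by simp
  rw [this, AlgHom.id_apply]

theorem act_mul {n : ℕ} (σ τ : Equiv.Perm (Fin n)) (f : Mould k n) :
    act (σ * τ) f = act σ (act τ f) := by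
  have : act (k := k) (σ * τ) = (act σ).comp (act τ) := hom_ext fun j => by simp
  rw [this, AlgHom.comp_apply]

theorem isLinearMap_comp_left {m n N : ℕ+} (h : (N : ℕ) + 1 = m + n) (i : Fin m)
    (g : Mould k n) : IsLinearMap k fun f : Mould k m => comp h i f g where
  map_add f f' := by
    simp only [comp, map_add]
    ring
  map_smul c f := by simp only [comp, map_smul, mul_smul_comm, smul_mul_assoc]

theorem isLinearMap_comp_right {m n N : ℕ+} (h : (N : ℕ) + 1 = m + n) (i : Fin m)
    (f : Mould k m) : IsLinearMap k fun g : Mould k n => comp h i f g where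
  map_add g g' := by
    simp only [comp, map_add]
    ring
  map_smul c g := by simp only [comp, map_smul, mul_smul_comm]

variable (k) in
/-- The variables `u_1, …, u_n` followed by `u_{n+1} = -u_1 - ⋯ - u_n`, as polynomials. -/
noncomputable def extPoly (n : ℕ) : Fin (n + 1) → MvPolynomial (Fin n) k :=
  Fin.snoc (α := fun _ => MvPolynomial (Fin n) k) MvPolynomial.X (-∑ l, MvPolynomial.X l)

theorem extPoly_castSucc {n : ℕ} (j : Fin n) : extPoly k n j.castSucc = MvPolynomial.X j :=
  Fin.snoc_castSucc (α := fun _ => MvPolynomial (Fin n) k) _ _ j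

theorem extPoly_last (n : ℕ) : extPoly k n (Fin.last n) = -∑ l, MvPolynomial.X l :=
  Fin.snoc_last (α := fun _ => MvPolynomial (Fin n) k) _ _

theorem sum_extPoly (n : ℕ) : ∑ b, extPoly k n b = 0 := by
  simp [Fin.sum_univ_castSucc, extPoly_castSucc, extPoly_last]

/-- A homomorphism that permutes `u_1, …, u_n` inside `u_1, …, u_{n+1}` also sends `u_{n+1}` to
the right place, because `u_1 + ⋯ + u_{n+1} = 0`. -/
theorem map_ext_of_castSucc {A B F : Type*} [AddCommGroup A] [AddCommGroup B] [FunLike F A B]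
    [AddMonoidHomClass F A B] {n : ℕ} (U : Fin (n + 1) → A) (V : Fin (n + 1) → B)
    (hU : ∑ b, U b = 0) (hV : ∑ b, V b = 0) (σ : Equiv.Perm (Fin (n + 1))) (φ : F)
    (h : ∀ j : Fin n, φ (U j.castSucc) = V (σ j.castSucc)) (b : Fin (n + 1)) :
    φ (U b) = V (σ b) := by
  induction b using Fin.lastCases with
  | cast j => exact h j
  | last =>
    have h1 : φ (∑ b, U b) = 0 := by rw [hU, map_zero]
    have h2 : ∑ b, V (σ b) = 0 := by rw [Equiv.sum_comp σ V, hV]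
    rw [Fin.sum_univ_castSucc, map_add, map_sum, Finset.sum_congr rfl fun j _ => h j] at h1
    rw [Fin.sum_univ_castSucc] at h2
    exact add_left_cancel (h1.trans h2.symm)

variable (k) in
/-- The variables `u_1, …, u_n` followed by `u_{n+1} = -u_1 - ⋯ - u_n`. -/
noncomputable def uExt (n : ℕ) (b : Fin (n + 1)) : Mould k n :=
  algebraMap (MvPolynomial (Fin n) k) (Mould k n) (extPoly k n b)

theorem uExt_castSucc {n : ℕ} (j : Fin n) : uExt k n j.castSucc = u k j := by
  rw [uExt, extPoly_castSucc, u]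

theorem sum_uExt (n : ℕ) : ∑ b, uExt k n b = 0 := by
  simp only [uExt]
  rw [← map_sum, sum_extPoly, map_zero]

theorem uExt_last (n : ℕ) : uExt k n (Fin.last n) = -∑ l, u k l := by
  simp [uExt, extPoly_last, u]

theorem uExt_independent {n : ℕ} (σ : Equiv.Perm (Fin (n + 1))) :
    AlgebraicIndependent k fun j : Fin n => uExt k n (σ j.castSucc) := by
  refine algebraicIndependent_of_leftInverse k (fun j => extPoly k n (σ j.castSucc))
    (fun a => extPoly k n (σ⁻¹ a.castSucc)) fun j => ?_
  rw [map_ext_of_castSucc (extPoly k n) (extPoly k n) (sum_extPoly n) (sum_extPoly n) σ⁻¹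
    (MvPolynomial.aeval fun a : Fin n => extPoly k n (σ⁻¹ a.castSucc)) (fun a => by
      rw [extPoly_castSucc, MvPolynomial.aeval_X])]
  simp [extPoly_castSucc]

/-- The action of `S_{n+1}` on moulds: permutations of `u_1, …, u_n` and
`u_{n+1} = -u_1 - ⋯ - u_n`. -/
noncomputable def actExt {n : ℕ} (σ : Equiv.Perm (Fin (n + 1))) : Mould k n →ₐ[k] Mould k n :=
  subst (fun j => uExt k n (σ j.castSucc)) (uExt_independent σ)

theorem actExt_uExt {n : ℕ} (σ : Equiv.Perm (Fin (n + 1))) (b : Fin (n + 1)) :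
    actExt σ (uExt k n b) = uExt k n (σ b) :=
  map_ext_of_castSucc _ _ (sum_uExt n) (sum_uExt n) σ _
    (fun j => by rw [uExt_castSucc, actExt, subst_u]) b

variable (k) in
/-- The linear representation of `S_{n+1}` on moulds of degree `n`. -/
noncomputable def extRep (n : ℕ) : Equiv.Perm (Fin (n + 1)) →* Module.End k (Mould k n) where
  toFun σ := (actExt σ).toLinearMap
  map_one' := by
    have : actExt (1 : Equiv.Perm (Fin (n + 1))) = AlgHom.id k (Mould k n) :=
      hom_ext fun j => by simp [← uExt_castSucc, actExt_uExt]
    rw [this]; rfl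
  map_mul' σ τ := by
    have : actExt (k := k) (σ * τ) = (actExt σ).comp (actExt τ) :=
      hom_ext fun j => by simp [← uExt_castSucc, actExt_uExt]
    rw [this]; rfl

theorem extRep_of_fix {n : ℕ} (σ : Equiv.Perm (Fin n)) (σ' : Equiv.Perm (Fin (n + 1)))
    (h : ∀ j : Fin n, σ' j.castSucc = (σ j).castSucc) (f : Mould k n) :
    extRep k n σ' f = act σ f := by
  have : actExt (k := k) σ' = act σ := hom_ext fun j => by
    rw [← uExt_castSucc, actExt_uExt, h, uExt_castSucc, uExt_castSucc, act_u]
  change actExt σ' f = _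
  rw [this]

theorem extRep_finRotate {n : ℕ} (f : Mould k n) :
    extRep k n (finRotate (n + 1)) f = cycle n f := by
  have : actExt (k := k) (finRotate (n + 1)) = cycle n := hom_ext fun j => by
    have hr : finRotate (n + 1) j.castSucc = j.succ := by
      rw [finRotate_apply, Fin.coeSucc_eq_succ]
    rw [← uExt_castSucc, actExt_uExt, hr, uExt_castSucc, cycle, subst_u, cycleArgs]
    split_ifs with hj
    · exact uExt_castSucc (⟨j + 1, hj⟩ : Fin n)
    · have : j.succ = Fin.last n := Fin.ext (by have := j.isLt; simp; omega)
      rw [this, uExt_last]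
  change actExt (finRotate (n + 1)) f = _
  rw [this]

end CyclicAction

end Mould

/-! ### The anticyclic operad of moulds -/

section Anticyclic

variable (k : Type u) [Field k]

theorem mouldOperad_isOperad : (mouldOperad k).IsOperad where
  act_one := Mould.act_one
  act_mul := Mould.act_mul
  act_linear σ := (Mould.act (k := k) σ).toLinearMap.isLinear
  comp_linear_left := Mould.isLinearMap_comp_left
  comp_linear_right := Mould.isLinearMap_comp_right
  comp_one := Mould.comp_one
  one_comp := Mould.one_comp
  comp_assoc := Mould.comp_assoc
  comp_comm := Mould.comp_comm
  comp_act := Mould.comp_act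

theorem mouldOperad_isAnticyclic :
    (mouldOperad k).IsAnticyclic fun n => Mould.cycle (k := k) n where
  isOperad := mouldOperad_isOperad k
  exists_action n := ⟨Mould.extRep k n, fun σ σ' _ h f => Mould.extRep_of_fix σ σ' h f,
    fun f => Mould.extRep_finRotate f⟩
  cycle_one := by
    change Mould.cycle (k := k) (1 : ℕ+) (Mould.u k _)⁻¹ = -(Mould.u k _)⁻¹
    rw [map_inv₀, Mould.cycle, Mould.subst_u, Mould.cycleArgs, dif_neg (by simp), inv_neg,
      neg_inj, inv_inj]
    exact Fin.sum_univ_one _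
  cycle_comp := Mould.cycle_comp
  cycle_comp_last := Mould.cycle_comp_last

end Anticyclic

/-! ### Restriction of an anticyclic structure to a suboperad -/

namespace PreOperad

variable {k : Type u} [Field k] {P : PreOperad.{u, v} k} {S : ∀ n, Submodule k (P.Obj n)}

theorem IsOperad.restrict (hP : P.IsOperad) (hS : P.IsSuboperad S) :
    (P.restrict S hS).IsOperad where
  act_one f := Subtype.ext (hP.act_one f.1)
  act_mul σ τ f := Subtype.ext (hP.act_mul σ τ f.1)
  act_linear σ :=
    { map_add := fun f g => Subtype.ext ((hP.act_linear σ).map_add f.1 g.1)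
      map_smul := fun c f => Subtype.ext ((hP.act_linear σ).map_smul c f.1) }
  comp_linear_left h i g :=
    { map_add := fun f f' => Subtype.ext ((hP.comp_linear_left h i g.1).map_add f.1 f'.1)
      map_smul := fun c f => Subtype.ext ((hP.comp_linear_left h i g.1).map_smul c f.1) }
  comp_linear_right h i f :=
    { map_add := fun g g' => Subtype.ext ((hP.comp_linear_right h i f.1).map_add g.1 g'.1)
      map_smul := fun c g => Subtype.ext ((hP.comp_linear_right h i f.1).map_smul c g.1) }
  comp_one h i f := Subtype.ext (hP.comp_one h i f.1)
  one_comp h i g := Subtype.ext (hP.one_comp h i g.1)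
  comp_assoc h₁ h₂ h₃ h₄ i j f g e := Subtype.ext (hP.comp_assoc h₁ h₂ h₃ h₄ i j f.1 g.1 e.1)
  comp_comm h₁ h₂ h₃ h₄ i j hij f g e :=
    Subtype.ext (hP.comp_comm h₁ h₂ h₃ h₄ i j hij f.1 g.1 e.1)
  comp_act h i σ τ ρ hσ hτ f g := Subtype.ext (hP.comp_act h i σ τ ρ hσ hτ f.1 g.1)

/-- Every permutation of `n + 1` points is a power of the cycle `j ↦ j + 1` times a permutation
that fixes the last point. -/
theorem exists_eq_finRotate_pow_mul {n : ℕ} (hn : 0 < n) (σ' : Equiv.Perm (Fin (n + 1))) :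
    ∃ (r : ℕ) (τ' : Equiv.Perm (Fin (n + 1))) (τ : Equiv.Perm (Fin n)),
      σ' = finRotate (n + 1) ^ r * τ' ∧ τ' (Fin.last n) = Fin.last n ∧
      ∀ j : Fin n, τ' j.castSucc = (τ j).castSucc := by
  obtain ⟨n, rfl⟩ := Nat.exists_eq_succ_of_ne_zero hn.ne'
  have hne : ∀ a : Fin (n + 2), finRotate (n + 2) a ≠ a := fun a => by
    rw [finRotate_apply]
    simp
  obtain ⟨r, hr⟩ := isCycle_finRotate.exists_pow_eq (hne (Fin.last (n + 1)))
    (hne (σ' (Fin.last (n + 1))))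
  have hlast : ((finRotate (n + 2) ^ r)⁻¹ * σ') (Fin.last (n + 1)) = Fin.last (n + 1) := by
    rw [Equiv.Perm.mul_apply, Equiv.Perm.inv_eq_iff_eq, hr]
  set τ' := (finRotate (n + 2) ^ r)⁻¹ * σ' with hτ'
  have hcast : ∀ j : Fin (n + 1), τ' j.castSucc ≠ Fin.last (n + 1) := fun j hj =>
    (Fin.castSucc_lt_last j).ne (τ'.injective (hj.trans hlast.symm))
  have hinj : Function.Injective fun j : Fin (n + 1) => (τ' j.castSucc).castPred (hcast j) := by
    intro a b hab
    exact Fin.castSucc_injective _ (τ'.injective (Fin.castPred_inj.mp hab))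
  refine ⟨r, τ', Equiv.ofBijective _ (Finite.injective_iff_bijective.mp hinj), ?_, hlast,
    fun j => ?_⟩
  · rw [hτ', mul_inv_cancel_left]
  · rw [Equiv.ofBijective_apply, Fin.castSucc_castPred]

theorem IsAnticyclic.restrict {γ : ∀ n : ℕ+, P.Obj n → P.Obj n} (hP : P.IsAnticyclic γ)
    (hS : P.IsSuboperad S) (hγ : ∀ (n : ℕ+) (f : P.Obj n), f ∈ S n → γ n f ∈ S n) :
    (P.restrict S hS).IsAnticyclic fun n f => ⟨γ n f.1, hγ n f.1 f.2⟩ where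
  isOperad := hP.isOperad.restrict hS
  exists_action n := by
    obtain ⟨ρ, hρ₁, hρ₂⟩ := hP.exists_action n
    have hpow : ∀ r : ℕ, ∀ f ∈ S n, ρ (finRotate (n + 1) ^ r) f ∈ S n := by
      intro r
      induction r with
      | zero => intro f hf; rwa [pow_zero, map_one]
      | succ r ih =>
        intro f hf
        rw [pow_succ, map_mul, Module.End.mul_apply, hρ₂]
        exact ih _ (hγ n f hf)
    have hmem : ∀ σ', ∀ f ∈ S n, ρ σ' f ∈ S n := by
      intro σ' f hf
      obtain ⟨r, τ', τ, rfl, hlast, hτ⟩ := exists_eq_finRotate_pow_mul n.pos σ'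
      rw [map_mul, Module.End.mul_apply, hρ₁ τ τ' hlast hτ]
      exact hpow r _ (hS.act_mem τ hf)
    refine ⟨{ toFun := fun σ' => (ρ σ').restrict (hmem σ')
              map_one' := ?_
              map_mul' := fun σ' τ' => ?_ }, fun σ σ' hl hσ f => ?_, fun f => ?_⟩
    · ext f
      change ρ 1 f.1 = f.1
      rw [map_one, Module.End.one_apply]
    · ext f
      change ρ (σ' * τ') f.1 = ρ σ' (ρ τ' f.1)
      rw [map_mul, Module.End.mul_apply]
    · exact Subtype.ext (hρ₁ σ σ' hl hσ f.1)
    · exact Subtype.ext (hρ₂ f.1)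
  cycle_one := Subtype.ext hP.cycle_one
  cycle_comp h i hi f g := Subtype.ext (hP.cycle_comp h i hi f.1 g.1)
  cycle_comp_last h h' i hi f g := Subtype.ext (hP.cycle_comp_last h h' i hi f.1 g.1)

end PreOperad

/-! ### Products of inverses of partial sums -/

section PrefixProd

variable {K : Type u} [Field K]

/-- The product `1 / ((s + x_1) (s + x_1 + x_2) ⋯ (s + x_1 + ⋯ + x_r))` of the inverses of the
partial sums of the list `x_1, …, x_r`, all shifted by `s`. -/
def prefixProd (s : K) : List K → K
  | [] => 1
  | x :: l => (s + x)⁻¹ * prefixProd (s + x) l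

@[simp]
theorem prefixProd_nil (s : K) : prefixProd s [] = 1 := rfl

theorem prefixProd_cons (s x : K) (l : List K) :
    prefixProd s (x :: l) = (s + x)⁻¹ * prefixProd (s + x) l := rfl

theorem prefixProd_append (s : K) (l l' : List K) :
    prefixProd s (l ++ l') = prefixProd s l * prefixProd (s + l.sum) l' := by
  induction l generalizing s with
  | nil => simp
  | cons x l ih => simp [prefixProd_cons, ih, mul_assoc, add_assoc]

theorem prefixProd_concat (s x : K) (l : List K) :
    prefixProd s (l ++ [x]) = prefixProd s l * (s + l.sum + x)⁻¹ := by
  simp [prefixProd_append, prefixProd_cons]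

theorem prefixProd_ofFn {n : ℕ} (s : K) (x : Fin n → K) :
    prefixProd s (List.ofFn x) = ∏ i : Fin n, (s + ∑ j ∈ Finset.Iic i, x j)⁻¹ := by
  induction n generalizing s with
  | zero => simp
  | succ n ih =>
    have hIic : ∀ i : Fin n, ∑ j ∈ Finset.Iic i.succ, x j =
        x 0 + ∑ j ∈ Finset.Iic i, x j.succ := by
      intro i
      simp only [← Finset.filter_ge_eq_Iic, Finset.sum_filter, Fin.sum_univ_succ, Fin.zero_le,
        if_true, Fin.succ_le_succ_iff]
    have h0 : ∑ j ∈ Finset.Iic (0 : Fin (n + 1)), x j = x 0 := by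
      simp only [← Finset.filter_ge_eq_Iic, Finset.sum_filter, Fin.le_zero_iff,
        Finset.sum_ite_eq', Finset.mem_univ, if_true]
    rw [List.ofFn_succ, prefixProd_cons, ih, Fin.prod_univ_succ, h0]
    simp only [hIic, add_assoc]

/-- Reading the letters from the total sum downwards: if the partial sums start from
`-(x + x_1 + ⋯ + x_r)` instead of `0`, they are up to sign the partial sums of the mirror word. -/
theorem prefixProd_neg (x : K) (l : List K) :
    (-(x + l.sum))⁻¹ * prefixProd (-(x + l.sum)) l =
      (-1) ^ (x :: l.reverse).length * prefixProd 0 (x :: l.reverse) := by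
  induction l with
  | nil => simp [prefixProd_cons, inv_neg]
  | cons y l ih =>
    have hs : -(x + (y :: l).sum) + y = -(x + l.sum) := by rw [List.sum_cons]; ring
    rw [prefixProd_cons, hs, ih, List.reverse_cons, ← List.cons_append, prefixProd_concat,
      List.length_append, pow_add, inv_neg, zero_add,
      show (x :: l.reverse).sum + y = x + (y :: l).sum by simp; ring]
    simp only [List.length_singleton, pow_one]
    ring

end PrefixProd

/-! ### Shuffles of words and the shuffle identity -/

section Shuffle

variable {α : Type u}

theorem IsShuffle.nil_left : ∀ b : List α, IsShuffle [] b b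
  | [] => .nil
  | x :: b => .right x (nil_left b)

theorem IsShuffle.nil_right : ∀ a : List α, IsShuffle a [] a
  | [] => .nil
  | x :: a => .left x (nil_right a)

theorem IsShuffle.eq_of_nil_left {a b w : List α} (h : IsShuffle a b w) (ha : a = []) : w = b := by
  induction h with
  | nil => rfl
  | left => exact absurd ha (List.cons_ne_nil _ _)
  | right x _ ih => rw [ih ha]

theorem IsShuffle.eq_of_nil_right {a b w : List α} (h : IsShuffle a b w) (hb : b = []) :
    w = a := by
  induction h with
  | nil => rfl
  | left x _ ih => rw [ih hb]
  | right => exact absurd hb (List.cons_ne_nil _ _)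

theorem IsShuffle.perm {a b w : List α} (h : IsShuffle a b w) : w.Perm (a ++ b) := by
  induction h with
  | nil => exact .nil
  | left x _ ih => exact ih.cons x
  | right x _ ih => exact (ih.cons x).trans List.perm_middle.symm

theorem IsShuffle.concat_left {a b w : List α} (h : IsShuffle a b w) (x : α) :
    IsShuffle (a ++ [x]) b (w ++ [x]) := by
  induction h with
  | nil => exact .left x .nil
  | left y _ ih => exact .left y ih
  | right y _ ih => exact .right y ih

theorem IsShuffle.concat_right {a b w : List α} (h : IsShuffle a b w) (x : α) :
    IsShuffle a (b ++ [x]) (w ++ [x]) := by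
  induction h with
  | nil => exact .right x .nil
  | left y _ ih => exact .left y ih
  | right y _ ih => exact .right y ih

theorem IsShuffle.reverse {a b w : List α} (h : IsShuffle a b w) :
    IsShuffle a.reverse b.reverse w.reverse := by
  induction h with
  | nil => exact .nil
  | left x _ ih => simpa using ih.concat_left x
  | right x _ ih => simpa using ih.concat_right x

variable [DecidableEq α]

/-- The set of the words in the shuffle of two words. -/
def shuffles : List α → List α → Finset (List α)
  | [], b => {b}
  | x :: a, [] => {x :: a}
  | x :: a, y :: b =>
    (shuffles a (y :: b)).image (x :: ·) ∪ (shuffles (x :: a) b).image (y :: ·)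

theorem mem_shuffles {a b w : List α} : w ∈ shuffles a b ↔ IsShuffle a b w := by
  induction a, b using shuffles.induct generalizing w with
  | case1 b =>
    rw [shuffles, Finset.mem_singleton]
    exact ⟨fun h => h ▸ .nil_left b, fun h => h.eq_of_nil_left rfl⟩
  | case2 x a =>
    rw [shuffles, Finset.mem_singleton]
    exact ⟨fun h => h ▸ .nil_right _, fun h => h.eq_of_nil_right rfl⟩
  | case3 x a y b ih₁ ih₂ =>
    simp only [shuffles, Finset.mem_union, Finset.mem_image]
    constructor
    · rintro (⟨w, hw, rfl⟩ | ⟨w, hw, rfl⟩)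
      · exact .left x (ih₁.mp hw)
      · exact .right y (ih₂.mp hw)
    · intro h
      cases h with
      | left _ h => exact .inl ⟨_, ih₁.mpr h, rfl⟩
      | right _ h => exact .inr ⟨_, ih₂.mpr h, rfl⟩

variable {K : Type v} [Field K]

/-- The shuffle identity for words read from right to left. The step is
`1/(pq) = 1/(p+q) (1/p + 1/q)`, where `p` and `q` are the sums of all letters of the two words. -/
theorem prefixProd_reverse_mul (x : α → K) (a b : List α) (hnd : (a ++ b).Nodup)
    (hx : ∀ w : List α, w ⊆ a ++ b → w.Nodup → w ≠ [] → (w.map x).sum ≠ 0) :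
    prefixProd 0 (a.map x).reverse * prefixProd 0 (b.map x).reverse =
      ∑ w ∈ shuffles a b, prefixProd 0 (w.map x).reverse := by
  induction a, b using shuffles.induct with
  | case1 b => simp [shuffles]
  | case2 y a => simp [shuffles]
  | case3 y a z b ih₁ ih₂ =>
    have hyz : y ≠ z := fun h => by
      subst h
      simp at hnd
    have hdisj : Disjoint ((shuffles a (z :: b)).image (y :: ·))
        ((shuffles (y :: a) b).image (z :: ·)) := by
      rw [Finset.disjoint_left]
      rintro w hw hw'
      obtain ⟨w₁, -, rfl⟩ := Finset.mem_image.mp hw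
      obtain ⟨w₂, -, h⟩ := Finset.mem_image.mp hw'
      exact hyz (List.cons_eq_cons.mp h).1.symm
    have hsum : ∀ {a' b' w : List α}, w ∈ shuffles a' b' →
        (w.map x).sum = (a'.map x).sum + (b'.map x).sum := fun h => by
      rw [((mem_shuffles.mp h).perm.map x).sum_eq, List.map_append, List.sum_append]
    rw [shuffles, Finset.sum_union hdisj,
      Finset.sum_image fun _ _ _ _ h => (List.cons_injective h),
      Finset.sum_image fun _ _ _ _ h => (List.cons_injective h)]
    have hstep : ∀ (c : α) (w : List α), prefixProd 0 ((c :: w).map x).reverse =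
        prefixProd 0 (w.map x).reverse * ((w.map x).sum + x c)⁻¹ := fun c w => by
      rw [List.map_cons, List.reverse_cons, prefixProd_concat, zero_add, List.sum_reverse]
    have h1 : ∑ w ∈ shuffles a (z :: b), prefixProd 0 ((y :: w).map x).reverse =
        (∑ w ∈ shuffles a (z :: b), prefixProd 0 (w.map x).reverse) *
          ((a.map x).sum + ((z :: b).map x).sum + x y)⁻¹ := by
      rw [Finset.sum_mul]
      exact Finset.sum_congr rfl fun w hw => by rw [hstep, hsum hw]
    have h2 : ∑ w ∈ shuffles (y :: a) b, prefixProd 0 ((z :: w).map x).reverse =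
        (∑ w ∈ shuffles (y :: a) b, prefixProd 0 (w.map x).reverse) *
          (((y :: a).map x).sum + (b.map x).sum + x z)⁻¹ := by
      rw [Finset.sum_mul]
      exact Finset.sum_congr rfl fun w hw => by rw [hstep, hsum hw]
    have hnd₁ : (a ++ z :: b).Nodup := (List.nodup_cons.mp hnd).2
    have hperm : ((y :: a) ++ z :: b).Perm (z :: ((y :: a) ++ b)) := List.perm_middle
    have hnd₂ : ((y :: a) ++ b).Nodup := (List.nodup_cons.mp (hperm.nodup_iff.mp hnd)).2
    rw [h1, h2, ← ih₁ hnd₁ fun w hw => hx w fun c hc => List.mem_cons_of_mem _ (hw hc),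
      ← ih₂ hnd₂ fun w hw => hx w fun c hc =>
        hperm.mem_iff.mpr (List.mem_cons_of_mem _ (hw hc)),
      hstep y a, hstep z b]
    have ha := hx (y :: a) (fun c hc => List.mem_append_left _ hc) (List.nodup_append.mp hnd).1
      (List.cons_ne_nil _ _)
    have hb := hx (z :: b) (fun c hc => List.mem_append_right _ hc)
      (List.nodup_append.mp hnd).2.1 (List.cons_ne_nil _ _)
    have hab := hx _ (fun c hc => hc) hnd (by simp)
    simp only [List.map_append, List.map_cons, List.sum_append, List.sum_cons] at ha hb hab ⊢
    have e1 : (a.map x).sum + (x z + (b.map x).sum) + x y =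
        x y + (a.map x).sum + (x z + (b.map x).sum) := by ring
    have e2 : x y + (a.map x).sum + (b.map x).sum + x z =
        x y + (a.map x).sum + (x z + (b.map x).sum) := by ring
    rw [e1, e2, add_comm (a.map x).sum, add_comm (b.map x).sum]
    field_simp

/-- The shuffle identity: the product of two prefix products is the sum of the prefix products
over the shuffle of the words. -/
theorem prefixProd_mul (x : α → K) (a b : List α) (hnd : (a ++ b).Nodup)
    (hx : ∀ w : List α, w ⊆ a ++ b → w.Nodup → w ≠ [] → (w.map x).sum ≠ 0) :
    prefixProd 0 (a.map x) * prefixProd 0 (b.map x) =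
      ∑ w ∈ shuffles a b, prefixProd 0 (w.map x) := by
  have hperm : (a.reverse ++ b.reverse).Perm (a ++ b) :=
    a.reverse_perm.append b.reverse_perm
  have := prefixProd_reverse_mul x a.reverse b.reverse (hperm.nodup_iff.mpr hnd)
    fun w hw => hx w fun c hc => hperm.mem_iff.mp (hw hc)
  simp only [← List.map_reverse, List.reverse_reverse] at this
  rw [this]
  refine Finset.sum_nbij' List.reverse List.reverse (fun w hw => ?_) (fun w hw => ?_)
    (fun w _ => w.reverse_reverse) (fun w _ => w.reverse_reverse) fun _ _ => rfl
  · have := (mem_shuffles.mp hw).reverse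
    simp only [List.reverse_reverse] at this
    exact mem_shuffles.mpr this
  · exact mem_shuffles.mpr (mem_shuffles.mp hw).reverse

end Shuffle

/-! ### One-line notation of permutations -/

section PermWord

theorem permWord_injective {n : ℕ} :
    Function.Injective (permWord : Equiv.Perm (Fin n) → List ℕ) := by
  intro σ τ h
  ext j
  have := congrFun (List.ofFn_injective h) j
  simpa using this

theorem permWord_one (n : ℕ) : permWord (1 : Equiv.Perm (Fin n)) = List.range' 1 n := by
  refine List.ext_getElem (by simp [permWord]) fun i h₁ h₂ => ?_
  simp [permWord, add_comm]

/-- The one-line notations of permutations are the rearrangements of `1, …, n`. -/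
theorem exists_permWord_eq {n : ℕ} {w : List ℕ} (hw : w.Perm (List.range' 1 n)) :
    ∃ σ : Equiv.Perm (Fin n), permWord σ = w := by
  have hlen : w.length = n := by simpa using hw.length_eq
  have hnd : w.Nodup := hw.nodup_iff.mpr (List.nodup_range')
  have hmem : ∀ c ∈ w, 1 ≤ c ∧ c < 1 + n := fun c hc => by
    simpa using List.mem_range'_1.mp (hw.mem_iff.mp hc)
  have hget : ∀ j : Fin n, 1 ≤ w[(j : ℕ)]'(by omega) ∧ w[(j : ℕ)]'(by omega) < 1 + n :=
    fun j => hmem _ (List.getElem_mem _)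
  let f : Fin n → Fin n := fun j => ⟨w[(j : ℕ)]'(by omega) - 1, by have := hget j; omega⟩
  have hf : Function.Injective f := by
    intro i j hij
    have h := Fin.ext_iff.mp hij
    simp only [f] at h
    have hi := hget i
    have hj := hget j
    exact Fin.ext ((List.Nodup.getElem_inj_iff hnd).mp (by omega))
  refine ⟨Equiv.ofBijective f (Finite.injective_iff_bijective.mp hf),
    List.ext_getElem (by simp [permWord, hlen]) fun i h₁ h₂ => ?_⟩
  have := hget ⟨i, by omega⟩
  simp only [permWord, List.getElem_ofFn, Equiv.ofBijective_apply, f]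
  simp only at this
  omega

end PermWord

/-! ### Composition and cycle on the permutational moulds -/

namespace Mould

section PermutationalMoulds

variable {k : Type u} [Field k]

variable (k) in
/-- The variable `u_c` attached to the letter `c`, which is counted from `1`. It is `0` if `c` is
larger than `n`; the letter `0` is not used, and gets `u_1` by truncated subtraction. -/
noncomputable def letterVar (n : ℕ) (c : ℕ) : Mould k n :=
  if h : c - 1 < n then u k ⟨c - 1, h⟩ else 0

theorem letterVar_succ {n : ℕ} (j : Fin n) : letterVar k n (j + 1) = u k j := by
  simp [letterVar]

theorem perm_eq_prefixProd_ofFn {n : ℕ} (σ : Equiv.Perm (Fin n)) :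
    perm k σ = prefixProd 0 (List.ofFn fun j => u k (σ j)) := by
  simp only [prefixProd_ofFn, perm, zero_add]

theorem perm_eq_prefixProd {n : ℕ} (σ : Equiv.Perm (Fin n)) :
    perm k σ = prefixProd 0 ((permWord σ).map (letterVar k n)) := by
  rw [perm_eq_prefixProd_ofFn, permWord, List.map_ofFn]
  congr 2
  funext j
  exact (letterVar_succ (σ j)).symm

theorem sum_letterVar_ne_zero {n : ℕ} {w : List ℕ} (hw : w ⊆ List.range' 1 n) (hnd : w.Nodup)
    (hne : w ≠ []) : (w.map (letterVar k n)).sum ≠ 0 := by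
  have hmem : ∀ c ∈ w, 1 ≤ c ∧ c < 1 + n := fun c hc => by
    simpa using List.mem_range'_1.mp (hw hc)
  have hinj : Function.Injective fun c : {c // c ∈ w.toFinset} =>
      (⟨c - 1, by have := hmem c (List.mem_toFinset.mp c.2); omega⟩ : Fin n) := by
    intro c d hcd
    have h := Fin.ext_iff.mp hcd
    simp only at h
    have hc := hmem c (List.mem_toFinset.mp c.2)
    have hd := hmem d (List.mem_toFinset.mp d.2)
    exact Subtype.ext (by omega)
  have hind := (algebraicIndependent_u k n).comp _ hinj
  have := sum_ne_zero (k := k) (E := Finset.univ) hind (by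
    obtain ⟨c, hc⟩ := List.exists_mem_of_ne_nil w hne
    exact ⟨⟨c, List.mem_toFinset.mpr hc⟩, Finset.mem_univ _⟩)
  rw [← List.sum_toFinset _ hnd, ← Finset.sum_coe_sort]
  convert this using 2 with c
  have := hmem c (List.mem_toFinset.mp c.2)
  rw [letterVar, dif_pos]
  rfl

open Classical in
/-- A sum over a set of rearrangements of `1, …, n` as a sum of permutational moulds. -/
theorem sum_prefixProd_eq_sum_perm {n : ℕ} (S : Finset (List ℕ))
    (hS : ∀ w ∈ S, w.Perm (List.range' 1 n)) (p : Equiv.Perm (Fin n) → Prop)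
    (hp : ∀ σ, p σ ↔ permWord σ ∈ S) :
    ∑ w ∈ S, prefixProd 0 (w.map (letterVar k n)) = ∑ σ with p σ, perm k σ := by
  symm
  refine Finset.sum_nbij permWord (fun σ hσ => ?_) permWord_injective.injOn (fun w hw => ?_)
    fun σ _ => perm_eq_prefixProd σ
  · exact (hp σ).mp (Finset.mem_filter.mp hσ).2
  · obtain ⟨σ, rfl⟩ := exists_permWord_eq (hS w hw)
    exact ⟨σ, by simpa using (hp σ).mpr hw, rfl⟩

theorem psum_add_one {n b : ℕ} (hb : b < n) :
    psum k n b + letterVar k n (b + 1) = psum k n (b + 1) := by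
  rw [psum_succ hb, letterVar, dif_pos (by simpa using hb)]
  rfl

theorem prefixProd_range' {n b l : ℕ} (hb : b + l ≤ n) (s : Mould k n) :
    prefixProd s ((List.range' (b + 1) l).map (letterVar k n)) =
      ∏ a ∈ Finset.range l, (s + (psum k n (b + (a + 1)) - psum k n b))⁻¹ := by
  induction l generalizing b s with
  | zero => simp
  | succ l ih =>
    rw [List.range'_succ, List.map_cons, prefixProd_cons, ih (by omega), Finset.prod_range_succ',
      mul_comm, zero_add, ← psum_add_one (show b < n by omega)]
    congr 1
    · refine Finset.prod_congr rfl fun a _ => ?_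
      rw [show b + 1 + (a + 1) = b + (a + 1 + 1) by ring]
      congr 1
      ring
    · congr 1
      ring

theorem sum_range' {n b l : ℕ} (hb : b + l ≤ n) :
    ((List.range' (b + 1) l).map (letterVar k n)).sum = psum k n (b + l) - psum k n b := by
  induction l generalizing b with
  | zero => simp
  | succ l ih =>
    rw [List.range'_succ, List.map_cons, List.sum_cons, ih (by omega),
      ← psum_add_one (show b < n by omega), show b + 1 + l = b + (l + 1) by ring]
    ring

theorem perm_one_eq {n : ℕ} :
    perm k (1 : Equiv.Perm (Fin n)) = ∏ a ∈ Finset.range n, (psum k n (a + 1))⁻¹ := by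
  have := prefixProd_range' (k := k) (n := n) (b := 0) (l := n) (by omega) 0
  rw [perm_eq_prefixProd, permWord_one]
  simpa [psum_zero] using this

open Classical in
/-- The factor `u_i + ⋯ + u_{i+n-1}` of the composition cancels the last factor of the inner mould.
What is left is the product of the moulds of the two shuffled words and of the inverses of the
partial sums that end in the common suffix of all the words on the right. -/
theorem comp_perm_one {m n N : ℕ+} (h : (N : ℕ) + 1 = m + n) (i : Fin m) :
    comp h i (perm k (1 : Equiv.Perm (Fin m))) (perm k (1 : Equiv.Perm (Fin n))) =
      ∑ σ : Equiv.Perm (Fin N) with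
        (∃ w, IsShuffle (List.range' 1 i) (List.range' ((i : ℕ) + 1) (n - 1)) w ∧
          permWord σ = w ++ List.range' ((i : ℕ) + n) (m - i)),
        perm k σ := by
  have hi := i.isLt
  have hn := n.pos
  have hAB : List.range' 1 i ++ List.range' ((i : ℕ) + 1) (n - 1) =
      List.range' 1 (i + (n - 1)) := by
    rw [add_comm (i : ℕ) 1, List.range'_append_1]
  have hABC : List.range' 1 (i + (n - 1)) ++ List.range' ((i : ℕ) + n) (m - i) =
      List.range' 1 N := by
    rw [show (i : ℕ) + n = 1 + (i + (n - 1)) by omega, List.range'_append_1]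
    congr 1
    omega
  have hS : ∀ w ∈ (shuffles (List.range' 1 i) (List.range' ((i : ℕ) + 1) (n - 1))).image
      (· ++ List.range' ((i : ℕ) + n) (m - i)), w.Perm (List.range' 1 N) := by
    intro w hw
    obtain ⟨w', hw', rfl⟩ := Finset.mem_image.mp hw
    rw [← hABC, ← hAB]
    exact (mem_shuffles.mp hw').perm.append_right _
  rw [← sum_prefixProd_eq_sum_perm _ hS _ fun σ => by
    simp only [Finset.mem_image, mem_shuffles]
    exact exists_congr fun w => and_congr_right fun _ => eq_comm]
  rw [Finset.sum_image fun _ _ _ _ hw => List.append_cancel_right hw]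
  -- the words of the shuffle have the same sum, so the common suffix contributes a common factor
  have hterm : ∀ w ∈ shuffles (List.range' 1 i) (List.range' ((i : ℕ) + 1) (n - 1)),
      prefixProd 0 ((w ++ List.range' ((i : ℕ) + n) (m - i)).map (letterVar k N)) =
        prefixProd 0 (w.map (letterVar k N)) *
        prefixProd (psum k N (i + (n - 1)))
          ((List.range' ((i : ℕ) + n) (m - i)).map (letterVar k N)) := by
    intro w hw
    have hperm := (mem_shuffles.mp hw).perm
    rw [hAB] at hperm
    have hs := sum_range' (k := k) (n := N) (b := 0) (l := i + (n - 1)) (by omega)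
    rw [psum_zero, sub_zero, zero_add] at hs
    rw [List.map_append, prefixProd_append, (hperm.map _).sum_eq, hs]
    simp
  rw [Finset.sum_congr rfl hterm, ← Finset.sum_mul, ← prefixProd_mul (letterVar k N) _ _
    (by rw [hAB]; exact List.nodup_range') fun w hw => sum_letterVar_ne_zero fun c hc => by
      have := hw hc
      rw [hAB] at this
      rw [← hABC]
      exact List.mem_append_left _ this]
  have hA := prefixProd_range' (k := k) (n := N) (b := 0) (l := i) (by omega) 0
  have hB := prefixProd_range' (k := k) (n := N) (b := i) (l := n - 1) (by omega) 0
  have hC := prefixProd_range' (k := k) (n := N) (b := i + (n - 1)) (l := m - i) (by omega)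
    (psum k N (i + (n - 1)))
  rw [show (i : ℕ) + (n - 1) + 1 = i + n by omega] at hC
  simp only [zero_add, psum_zero, sub_zero, add_sub_cancel] at hA hB hC
  rw [hA, hB, hC, comp_eq, perm_one_eq, perm_one_eq, map_prod, map_prod]
  simp only [map_inv₀]
  have hm : Finset.range m = Finset.range (i + (m - i)) := congrArg _ (by omega)
  have houter : ∏ a ∈ Finset.range m,
      (subst (outerArgs k h i) (outerArgs_independent k h i) (psum k m (a + 1)))⁻¹ =
      (∏ a ∈ Finset.range i, (psum k N (a + 1))⁻¹) *
      ∏ a ∈ Finset.range (m - i), (psum k N (i + (n - 1) + (a + 1)))⁻¹ := by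
    rw [Finset.prod_congr rfl fun a ha => by
      rw [outer_psum h i (a := a + 1) (Finset.mem_range.mp ha)]]
    rw [hm, Finset.prod_range_add]
    congr 1
    · refine Finset.prod_congr rfl fun a ha => ?_
      rw [if_pos (show a + 1 ≤ (i : ℕ) from Finset.mem_range.mp ha)]
    · refine Finset.prod_congr rfl fun a ha => ?_
      rw [if_neg (by omega)]
      congr 2
      omega
  have hinner : (psum k N (i + n) - psum k N i) * ∏ a ∈ Finset.range n,
      (subst (innerArgs k h i) (innerArgs_independent k h i) (psum k n (a + 1)))⁻¹ =
      ∏ a ∈ Finset.range (n - 1), (psum k N (i + (a + 1)) - psum k N i)⁻¹ := by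
    have hne : psum k N (i + n) - psum k N i ≠ 0 := by
      rw [← sum_range' (by omega)]
      refine sum_letterVar_ne_zero (fun c hc => ?_) List.nodup_range' (by simp)
      rw [List.mem_range'_1] at hc ⊢
      omega
    rw [Finset.prod_congr rfl fun a ha => by
      rw [inner_psum h i (a := a + 1) (Finset.mem_range.mp ha)]]
    obtain ⟨n', hn'⟩ := Nat.exists_eq_succ_of_ne_zero hn.ne'
    rw [hn'] at hne ⊢
    rw [Finset.prod_range_succ, Nat.succ_sub_one, mul_comm, mul_assoc, inv_mul_cancel₀ hne,
      mul_one]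
  rw [houter, mul_right_comm, hinner]
  ring

theorem shiftedPermWord_perm {n : ℕ} (hn : 0 < n) (σ : Equiv.Perm (Fin n)) :
    (shiftedPermWord σ).Perm (List.range' 1 n) := by
  have hnd : (shiftedPermWord σ).Nodup := by
    refine List.nodup_ofFn_ofInjective fun i j hij => σ.injective (Fin.ext ?_)
    have hi := (σ i).isLt
    have hj := (σ j).isLt
    have hmod : ∀ a : ℕ, a < n → (a + 1) % n = if a + 1 = n then 0 else a + 1 := fun a ha => by
      split_ifs with h
      · rw [h, Nat.mod_self]
      · exact Nat.mod_eq_of_lt (by omega)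
    simp only [hmod _ hi, hmod _ hj] at hij
    split_ifs at hij <;> omega
  refine (hnd.subperm fun c hc => ?_).perm_of_length_le (by simp [shiftedPermWord])
  obtain ⟨j, rfl⟩ := List.mem_ofFn.mp hc
  rw [List.mem_range'_1]
  have := Nat.mod_lt ((σ j : ℕ) + 1) hn
  omega

open Classical in
/-- The cycle puts `-u_1 - ⋯ - u_n` in the place of the letter `1` of the shifted word
`a 1 w`. The partial sums up to `a` are unchanged, and after it they are, up to sign, those of the
word `1 w̄`. -/
theorem cycle_perm {n : ℕ+} (σ : Equiv.Perm (Fin n)) (a w : List ℕ)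
    (hσ : shiftedPermWord σ = a ++ 1 :: w) :
    cycle n (perm k σ) = (-1) ^ (1 :: w.reverse).length *
      ∑ τ : Equiv.Perm (Fin n) with IsShuffle a (1 :: w.reverse) (permWord τ), perm k τ := by
  have hperm := shiftedPermWord_perm n.pos σ
  rw [hσ] at hperm
  have hnd : (a ++ 1 :: w).Nodup := hperm.nodup_iff.mpr List.nodup_range'
  have hperm' : (a ++ 1 :: w.reverse).Perm (List.range' 1 n) :=
    ((w.reverse_perm.cons 1).append_left a).trans hperm
  have h1 : 1 ∉ a ∧ 1 ∉ w := by
    have := List.nodup_cons.mp (List.perm_middle.nodup_iff.mp hnd)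
    simpa using this.1
  rw [← sum_prefixProd_eq_sum_perm (shuffles a (1 :: w.reverse))
    (fun v hv => (mem_shuffles.mp hv).perm.trans hperm') _ fun τ => mem_shuffles.symm,
    ← prefixProd_mul _ _ _ (hperm'.nodup_iff.mpr List.nodup_range')
      fun v hv => sum_letterVar_ne_zero fun c hc => hperm'.mem_iff.mp (hv hc)]
  -- the value of the variable attached to each letter of the shifted word
  let x : ℕ → Mould k n := fun c => if c = 1 then -∑ l : Fin n, u k l else letterVar k n c
  have hx : ∀ v : List ℕ, 1 ∉ v → v.map x = v.map (letterVar k n) := fun v hv =>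
    List.map_congr_left fun c hc => if_neg (by rintro rfl; exact hv hc)
  have hcyc : ∀ j : Fin n, cycle n (u k (σ j)) = x (((σ j : ℕ) + 1) % n + 1) := by
    intro j
    rw [cycle, subst_u, cycleArgs]
    have := (σ j).isLt
    split_ifs with hj
    · rw [Nat.mod_eq_of_lt hj]
      simp only [x]
      rw [if_neg (by omega)]
      exact (letterVar_succ (⟨σ j + 1, hj⟩ : Fin n)).symm
    · rw [show (σ j : ℕ) + 1 = n by omega, Nat.mod_self, zero_add]
      exact (if_pos rfl).symm
  have hmap : ∀ (s : Mould k n) (l : List (Mould k n)),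
      cycle n (prefixProd s l) = prefixProd (cycle n s) (l.map (cycle n)) := by
    intro s l
    induction l generalizing s with
    | nil => simp
    | cons y l ih => simp only [prefixProd_cons, List.map_cons, map_mul, map_inv₀, map_add, ih]
  -- the partial sum that ends in the letter `1`; the letters are `1, …, n`, each occurring once
  have htotal : (a.map (letterVar k n)).sum + -∑ l : Fin n, u k l =
      -(letterVar k n 1 + (w.map (letterVar k n)).sum) := by
    have h := (hperm.map (letterVar k n)).sum_eq
    have hr := sum_range' (k := k) (n := n) (b := 0) (l := n) (by omega)
    rw [zero_add, zero_add, psum_zero, sub_zero, ← sum_u_eq_psum] at hr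
    rw [hr, List.map_append, List.map_cons, List.sum_append, List.sum_cons] at h
    rw [← h]
    ring
  have hword : (List.ofFn fun j => u k (σ j)).map (cycle n) =
      a.map (letterVar k n) ++ (-∑ l : Fin n, u k l) :: w.map (letterVar k n) := by
    rw [List.map_ofFn, ← hx a h1.1, ← hx w h1.2,
      show (-∑ l : Fin n, u k l) = x 1 from (if_pos rfl).symm, ← List.map_cons,
      ← List.map_append, ← hσ, shiftedPermWord, List.map_ofFn]
    exact congrArg List.ofFn (funext hcyc)
  rw [perm_eq_prefixProd_ofFn, hmap, hword, map_zero, prefixProd_append, zero_add,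
    prefixProd_cons, htotal, prefixProd_neg, ← List.map_reverse, List.map_cons]
  simp only [List.length_cons, List.length_map, List.length_reverse]
  ring

end PermutationalMoulds

end Mould

/-! ### A Zinbiel algebra of functions on finite sets -/

section HalfShuffle

variable {X : Type v} {K : Type w} [Field K]

/-- Functions on the finite subsets of `X`, as the carrier of the product
`(a ≺ b)(E) = ∑_{A ⊂ E} (s_A / s_E) a(A) b(E \ A)`, where `s_A` is the sum of the weights `x c`
of the elements `c` of `A`. In terms of the commutative product `(a b)(E) = ∑ a(A) b(E \ A)` and
of the derivation `D` with `(D a)(E) = s_E a(E)`, this is `a ≺ b = D⁻¹ (D(a) b)`, the integral of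
`a' b`. The sum is over the proper subsets, so that `D⁻¹` is not needed in degree `∅`. -/
def HalfShuffleAlgebra (_x : X → K) : Type (max v w) := Finset X → K

namespace HalfShuffleAlgebra

variable (x : X → K)

instance : AddCommGroup (HalfShuffleAlgebra x) := inferInstanceAs (AddCommGroup (Finset X → K))

instance {k : Type u} [Field k] [Algebra k K] : Module k (HalfShuffleAlgebra x) :=
  inferInstanceAs (Module k (Finset X → K))

variable {x} in
theorem add_apply (a b : HalfShuffleAlgebra x) (E : Finset X) : (a + b) E = a E + b E := rfl

variable {x} in
theorem zero_apply (E : Finset X) : (0 : HalfShuffleAlgebra x) E = 0 := rfl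

variable {x} in
theorem smul_apply {k : Type u} [Field k] [Algebra k K] (r : k) (a : HalfShuffleAlgebra x)
    (E : Finset X) : (r • a) E = r • a E := rfl

variable [DecidableEq X]

/-- The function with value `1 / x_c` at `{c}`. -/
noncomputable def gen (c : X) : HalfShuffleAlgebra x :=
  fun E : Finset X => if E = {c} then (x c)⁻¹ else 0

noncomputable instance : Mul (HalfShuffleAlgebra x) where
  mul a b := fun E => ∑ A ∈ E.ssubsets, (∑ c ∈ A, x c) / (∑ c ∈ E, x c) * a A * b (E \ A)

variable {x}

theorem mul_apply (a b : HalfShuffleAlgebra x) (E : Finset X) :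
    (a * b) E = ∑ A ∈ E.ssubsets, (∑ c ∈ A, x c) / (∑ c ∈ E, x c) * a A * b (E \ A) := rfl

theorem gen_apply (c : X) (E : Finset X) : gen x c E = if E = {c} then (x c)⁻¹ else 0 :=
  rfl

noncomputable instance : NonUnitalNonAssocRing (HalfShuffleAlgebra x) where
  left_distrib a b c := by
    funext E
    simp only [add_apply, mul_apply, mul_add, Finset.sum_add_distrib]
  right_distrib a b c := by
    funext E
    simp only [add_apply, mul_apply, mul_add, add_mul, Finset.sum_add_distrib]
  zero_mul a := by
    funext E
    simp only [zero_apply, mul_apply, mul_zero, zero_mul, Finset.sum_const_zero]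
  mul_zero a := by
    funext E
    simp only [zero_apply, mul_apply, mul_zero, Finset.sum_const_zero]

instance {k : Type u} [Field k] [Algebra k K] :
    IsScalarTower k (HalfShuffleAlgebra x) (HalfShuffleAlgebra x) where
  smul_assoc r a b := by
    funext E
    simp only [smul_eq_mul, smul_apply, mul_apply, Finset.smul_sum, mul_smul_comm, smul_mul_assoc]

instance {k : Type u} [Field k] [Algebra k K] :
    SMulCommClass k (HalfShuffleAlgebra x) (HalfShuffleAlgebra x) where
  smul_comm r a b := by
    funext E
    simp only [smul_eq_mul, smul_apply, mul_apply, Finset.smul_sum, mul_smul_comm]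

/-- The symmetrization of the half-shuffle product is the commutative product. -/
theorem mul_add_mul_apply (hx : ∀ E : Finset X, E.Nonempty → ∑ c ∈ E, x c ≠ 0)
    (b c : HalfShuffleAlgebra x) {F : Finset X} (hF : F.Nonempty) :
    (b * c + c * b) F = ∑ B ∈ F.ssubsets with B.Nonempty, b B * c (F \ B) := by
  have hdrop : ∀ b c : HalfShuffleAlgebra x, (b * c) F = ∑ B ∈ F.ssubsets with B.Nonempty,
      (∑ c ∈ B, x c) / (∑ c ∈ F, x c) * b B * c (F \ B) := by
    intro b c
    rw [mul_apply, Finset.sum_filter_of_ne]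
    intro B _ hB
    rw [Finset.nonempty_iff_ne_empty]
    rintro rfl
    simp at hB
  have hswap : (c * b) F = ∑ B ∈ F.ssubsets with B.Nonempty,
      (∑ c ∈ F \ B, x c) / (∑ c ∈ F, x c) * b B * c (F \ B) := by
    rw [hdrop]
    have hmem : ∀ B ∈ F.ssubsets.filter (·.Nonempty), F \ B ∈ F.ssubsets.filter (·.Nonempty) := by
      intro B hB
      simp only [Finset.mem_filter, Finset.mem_ssubsets] at hB ⊢
      exact ⟨Finset.sdiff_ssubset hB.1.1 hB.2, Finset.sdiff_nonempty.mpr hB.1.2⟩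
    have hinv : ∀ B ∈ F.ssubsets.filter (·.Nonempty), F \ (F \ B) = B := fun B hB => by
      simp only [Finset.mem_filter, Finset.mem_ssubsets] at hB
      exact Finset.sdiff_sdiff_eq_self hB.1.1
    refine Finset.sum_nbij' (F \ ·) (F \ ·) hmem hmem hinv hinv fun B hB => ?_
    rw [hinv B hB]
    ring
  rw [add_apply, hdrop, hswap, ← Finset.sum_add_distrib]
  refine Finset.sum_congr rfl fun B hB => ?_
  simp only [Finset.mem_filter, Finset.mem_ssubsets] at hB
  have hsum : ∑ c ∈ F, x c = (∑ c ∈ B, x c) + ∑ c ∈ F \ B, x c := by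
    rw [add_comm, Finset.sum_sdiff hB.1.1]
  have h1 : (∑ c ∈ B, x c) / (∑ c ∈ F, x c) + (∑ c ∈ F \ B, x c) / (∑ c ∈ F, x c) = 1 := by
    rw [← add_div, ← hsum, div_self (hx F hF)]
  rw [← add_mul, ← add_mul, h1, one_mul]

/-- The Zinbiel relation: both sides are `D⁻¹ (D(a) b c)`. -/
theorem mul_mul_eq (hx : ∀ E : Finset X, E.Nonempty → ∑ c ∈ E, x c ≠ 0)
    (a b c : HalfShuffleAlgebra x) : a * b * c = a * (b * c) + a * (c * b) := by
  funext E
  have hl : (a * b * c) E = ∑ C ∈ E.ssubsets, ∑ A ∈ C.ssubsets,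
      (∑ c ∈ A, x c) / (∑ c ∈ E, x c) * a A * (b (C \ A) * c (E \ C)) := by
    rw [mul_apply]
    refine Finset.sum_congr rfl fun C _ => ?_
    rw [mul_apply, Finset.mul_sum, Finset.sum_mul]
    refine Finset.sum_congr rfl fun A hA => ?_
    have hC : C.Nonempty := Finset.nonempty_iff_ne_empty.mpr fun h => by simp [h] at hA
    have := hx C hC
    field_simp
  have hr : (a * (b * c + c * b)) E = ∑ A ∈ E.ssubsets,
      ∑ B ∈ (E \ A).ssubsets with B.Nonempty,
      (∑ c ∈ A, x c) / (∑ c ∈ E, x c) * a A * (b B * c ((E \ A) \ B)) := by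
    rw [mul_apply]
    refine Finset.sum_congr rfl fun A hA => ?_
    rw [mul_add_mul_apply hx b c (Finset.sdiff_nonempty.mpr (Finset.mem_ssubsets.mp hA).2),
      Finset.mul_sum]
  -- both sides are sums over chains `A ⊂ C ⊂ E`, the set `C` being `A ∪ B` on the right
  rw [← mul_add, hl, hr, Finset.sum_sigma', Finset.sum_sigma']
  refine Finset.sum_bij' (fun p _ => ⟨p.2, p.1 \ p.2⟩) (fun q _ => ⟨q.1 ∪ q.2, q.1⟩)
    ?_ ?_ ?_ ?_ ?_
  · rintro ⟨C, A⟩ h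
    simp only [Finset.mem_sigma, Finset.mem_ssubsets, Finset.mem_filter] at h ⊢
    refine ⟨h.2.trans h.1, ⟨Finset.sdiff_subset_sdiff h.1.1 subset_rfl, fun hh => h.1.2 ?_⟩,
      Finset.sdiff_nonempty.mpr h.2.2⟩
    intro c hc
    by_cases hA : c ∈ A
    · exact h.2.1 hA
    · exact (Finset.mem_sdiff.mp (hh (Finset.mem_sdiff.mpr ⟨hc, hA⟩))).1
  · rintro ⟨A, B⟩ h
    simp only [Finset.mem_sigma, Finset.mem_ssubsets, Finset.mem_filter] at h ⊢
    obtain ⟨hA, hB, hne⟩ := h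
    refine ⟨⟨Finset.union_subset hA.1 (hB.1.trans Finset.sdiff_subset), fun hh => hB.2 ?_⟩,
      Finset.subset_union_left, fun hh => ?_⟩
    · intro c hc
      obtain ⟨hcE, hcA⟩ := Finset.mem_sdiff.mp hc
      exact (Finset.mem_union.mp (hh hcE)).resolve_left hcA
    · obtain ⟨c, hc⟩ := hne
      exact (Finset.mem_sdiff.mp (hB.1 hc)).2 (hh (Finset.mem_union_right _ hc))
  · rintro ⟨C, A⟩ h
    simp only [Finset.mem_sigma, Finset.mem_ssubsets] at h
    simp [Finset.union_sdiff_of_subset h.2.1]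
  · rintro ⟨A, B⟩ h
    simp only [Finset.mem_sigma, Finset.mem_ssubsets, Finset.mem_filter] at h
    have hd : Disjoint A B := Finset.disjoint_left.mpr fun c hcA hcB =>
      (Finset.mem_sdiff.mp (h.2.1.1 hcB)).2 hcA
    simp [Finset.union_sdiff_cancel_left hd]
  · rintro ⟨C, A⟩ h
    simp only [Finset.mem_sigma, Finset.mem_ssubsets] at h
    dsimp only
    rw [sdiff_sdiff_left, Finset.sup_eq_union, Finset.union_sdiff_of_subset h.2.1]

end HalfShuffleAlgebra

end HalfShuffle

/-! ### Rational functions attached to nonassociative monomials -/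

namespace FreeMagma

variable {X : Type v} {Y : Type u} {K : Type w} [Field K]

/-- The sum of the weights of the leaves of a nonassociative monomial. -/
def weight (x : X → K) : FreeMagma X → K
  | .of c => x c
  | .mul s t => s.weight x + t.weight x

/-- The rational function attached to a nonassociative monomial: `1 / x_c` for the generator `c`,
and for a product of `s` and `t` the product of the two functions and of
`weight s / (weight s + weight t)`. -/
def ratio (x : X → K) : FreeMagma X → K
  | .of c => (x c)⁻¹
  | .mul s t => s.weight x / (s.weight x + t.weight x) * s.ratio x * t.ratio x

theorem weight_of (x : X → K) (c : X) : (of c).weight x = x c := rfl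

theorem weight_mul (x : X → K) (s t : FreeMagma X) :
    (s * t).weight x = s.weight x + t.weight x := rfl

theorem ratio_of (x : X → K) (c : X) : (of c).ratio x = (x c)⁻¹ := rfl

theorem ratio_mul (x : X → K) (s t : FreeMagma X) :
    (s * t).ratio x = s.weight x / (s.weight x + t.weight x) * s.ratio x * t.ratio x := rfl

theorem content_of (c : X) : (of c).content = {c} := rfl

theorem content_mul (s t : FreeMagma X) : (s * t).content = s.content + t.content := rfl

theorem content_ne_zero (t : FreeMagma X) : t.content ≠ 0 := by
  induction t using recOnMul with
  | ih1 c => exact Multiset.singleton_ne_zero c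
  | ih2 s t hs _ => exact fun h => hs (add_eq_zero.mp h).1

theorem weight_eq (x : X → K) (t : FreeMagma X) : t.weight x = (t.content.map x).sum := by
  induction t using recOnMul with
  | ih1 c => simp [weight_of, content_of]
  | ih2 s t hs ht => rw [weight_mul, content_mul, Multiset.map_add, Multiset.sum_add, hs, ht]

theorem content_lift (τ : X → FreeMagma Y) (t : FreeMagma X) :
    (lift τ t).content = t.content.bind fun c => (τ c).content := by
  induction t using recOnMul with
  | ih1 c => simp [content_of]
  | ih2 s t hs ht => rw [map_mul, content_mul, content_mul, Multiset.add_bind, hs, ht]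

theorem weight_lift (y : Y → K) (τ : X → FreeMagma Y) (t : FreeMagma X) :
    (lift τ t).weight y = t.weight fun c => (τ c).weight y := by
  induction t using recOnMul with
  | ih1 c => simp [weight_of]
  | ih2 s t hs ht => rw [map_mul, weight_mul, weight_mul, hs, ht]

/-- Substitution of monomials for the generators: the function of the outer monomial is taken at
the weights of the inner ones, and each inner monomial contributes its function times its
weight. -/
theorem ratio_lift (y : Y → K) (τ : X → FreeMagma Y) (t : FreeMagma X)
    (hτ : ∀ c, (τ c).weight y ≠ 0) :
    (lift τ t).ratio y = t.ratio (fun c => (τ c).weight y) *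
      (t.content.map fun c => (τ c).weight y * (τ c).ratio y).prod := by
  induction t using recOnMul with
  | ih1 c =>
    rw [lift_of, ratio_of, content_of, Multiset.map_singleton, Multiset.prod_singleton,
      inv_mul_cancel_left₀ (hτ c)]
  | ih2 s t hs ht =>
    rw [map_mul, ratio_mul, ratio_mul, content_mul, Multiset.map_add, Multiset.prod_add, hs, ht,
      weight_lift, weight_lift]
    ring

theorem ratio_lift_of (y : Y → K) (ρ : X → Y) (t : FreeMagma X) :
    (lift (fun c => of (ρ c)) t).ratio y = t.ratio fun c => y (ρ c) := by
  induction t using recOnMul with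
  | ih1 c => rw [lift_of, ratio_of, ratio_of]
  | ih2 s t hs ht =>
    rw [map_mul, ratio_mul, ratio_mul, hs, ht, weight_lift, weight_lift]
    rfl

theorem map_weight {L : Type*} [Field L] (φ : K →+* L) (x : X → K) (t : FreeMagma X) :
    φ (t.weight x) = t.weight fun c => φ (x c) := by
  induction t using recOnMul with
  | ih1 c => rfl
  | ih2 s t hs ht => rw [weight_mul, weight_mul, map_add, hs, ht]

theorem map_ratio {L : Type*} [Field L] (φ : K →+* L) (x : X → K) (t : FreeMagma X) :
    φ (t.ratio x) = t.ratio fun c => φ (x c) := by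
  induction t using recOnMul with
  | ih1 c => rw [ratio_of, ratio_of, map_inv₀]
  | ih2 s t hs ht =>
    rw [ratio_mul, ratio_mul, map_mul, map_mul, map_div₀, map_add, hs, ht, map_weight, map_weight]

end FreeMagma

/-! ### Realization of the free Zinbiel algebra and spanning by words -/

namespace FreeZinbiel

theorem monomial_of {k : Type u} [Field k] {X : Type v} (c : X) :
    monomial k (FreeMagma.of c) = gen k c :=
  FreeMagma.lift_of _ _

section Realization

variable (k : Type u) [Field k] {X : Type v} [DecidableEq X] {K : Type w} [Field K] [Algebra k K]

/-- The homomorphism from the free Zinbiel algebra to the half-shuffle algebra that sends the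
generators to the functions `HalfShuffleAlgebra.gen`. -/
noncomputable def toHalfShuffle (x : X → K)
    (hx : ∀ E : Finset X, E.Nonempty → ∑ c ∈ E, x c ≠ 0) :
    FreeZinbiel k X →ₗ[k] HalfShuffleAlgebra x :=
  (zinbielIdeal k X).liftQ
    (FreeNonUnitalNonAssocAlgebra.lift k (HalfShuffleAlgebra.gen x) :
      FreeNonUnitalNonAssocAlgebra k X →ₙₐ[k] HalfShuffleAlgebra x)
    (zinbielIdeal_le_ker (HalfShuffleAlgebra.mul_mul_eq hx) _)

variable {k} {x : X → K} {hx : ∀ E : Finset X, E.Nonempty → ∑ c ∈ E, x c ≠ 0}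

theorem toHalfShuffle_mk (a : FreeNonUnitalNonAssocAlgebra k X) :
    toHalfShuffle k x hx (mk k X a) =
      FreeNonUnitalNonAssocAlgebra.lift k (HalfShuffleAlgebra.gen x) a := rfl

theorem toHalfShuffle_gen (c : X) :
    toHalfShuffle k x hx (gen k c) = HalfShuffleAlgebra.gen x c := by
  rw [gen, toHalfShuffle_mk, FreeNonUnitalNonAssocAlgebra.lift_of_apply]

theorem toHalfShuffle_mul (a b : FreeZinbiel k X) :
    toHalfShuffle k x hx (a * b) = toHalfShuffle k x hx a * toHalfShuffle k x hx b := by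
  obtain ⟨a, rfl⟩ := mk_surjective k X a
  obtain ⟨b, rfl⟩ := mk_surjective k X b
  rw [← mk_mul, toHalfShuffle_mk, toHalfShuffle_mk, toHalfShuffle_mk, map_mul]

/-- The image of a monomial is concentrated at its content; it vanishes if a generator occurs
twice. -/
theorem toHalfShuffle_monomial (t : FreeMagma X) (E : Finset X) :
    toHalfShuffle k x hx (monomial k t) E = if E.val = t.content then t.ratio x else 0 := by
  induction t using FreeMagma.recOnMul generalizing E with
  | ih1 c =>
    rw [monomial_of, toHalfShuffle_gen, HalfShuffleAlgebra.gen_apply, FreeMagma.content_of,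
      FreeMagma.ratio_of]
    simp only [← Finset.singleton_val, Finset.val_inj]
  | ih2 s t hs ht =>
    rw [map_mul, toHalfShuffle_mul, HalfShuffleAlgebra.mul_apply, FreeMagma.content_mul,
      FreeMagma.ratio_mul]
    simp only [hs, ht]
    split_ifs with hE
    · have hnd : (s.content + t.content).Nodup := hE ▸ E.nodup
      set A : Finset X := ⟨s.content, (Multiset.nodup_add.mp hnd).1⟩ with hA
      have hAv : A.val = s.content := rfl
      have hAE : A ⊆ E := Finset.val_le_iff.mp (by rw [hE, hAv]; exact Multiset.le_add_right _ _)
      have hdiff : (E \ A).val = t.content := by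
        rw [Finset.sdiff_val, hE, hAv, add_tsub_cancel_left]
      have hne : A ≠ E := fun h => t.content_ne_zero (by
        rw [h, Finset.sdiff_self] at hdiff
        exact hdiff.symm)
      rw [Finset.sum_eq_single A]
      · have h1 : ∑ c ∈ A, x c = s.weight x := (s.weight_eq x).symm
        have h2 : ∑ c ∈ E, x c = s.weight x + t.weight x := by
          rw [← FreeMagma.weight_mul, FreeMagma.weight_eq, FreeMagma.content_mul, ← hE]
          rfl
        rw [if_pos hAv, if_pos hdiff, h1, h2]
      · intro B _ hB
        rw [if_neg fun h => hB (Finset.val_inj.mp (h.trans hAv.symm)), mul_zero, zero_mul]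
      · exact fun h => absurd (Finset.mem_ssubsets.mpr (hAE.ssubset_of_ne hne)) h
    · refine Finset.sum_eq_zero fun A hA => ?_
      split_ifs with h1 h2
      · refine absurd ?_ hE
        rw [← h1, ← h2, Finset.sdiff_val]
        exact (add_tsub_cancel_of_le (Finset.val_le_iff.mpr (Finset.mem_ssubsets.mp hA).1)).symm
      all_goals simp

end Realization

section Words

variable {k : Type u} [Field k] {X : Type v}

/-- The words of content `c` span a subspace that contains the products of words: by the Zinbiel
relation, `(x u) v = x (u v + v u)`. -/
theorem wordMonomial_mul_mem (w₁ w₂ : List X) (h₁ : w₁ ≠ []) (h₂ : w₂ ≠ []) :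
    Zinbiel.wordMonomial k w₁ * Zinbiel.wordMonomial k w₂ ∈
      Submodule.span k (Zinbiel.wordMonomial k ''
        {w | w ≠ [] ∧ (w : Multiset X) = (w₁ : Multiset X) + w₂}) := by
  induction hl : w₁.length + w₂.length using Nat.strong_induction_on generalizing w₁ w₂ with
  | _ l ih =>
  have hcons : ∀ (c : X) {w : List X}, w ≠ [] → gen k c * Zinbiel.wordMonomial k w =
      Zinbiel.wordMonomial k (c :: w) := by
    rintro c (_ | ⟨d, w⟩) h
    · exact absurd rfl h
    · rfl
  have hgen : ∀ (c : X) (m : Multiset X) (a : FreeZinbiel k X),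
      a ∈ Submodule.span k (Zinbiel.wordMonomial k '' {w | w ≠ [] ∧ (w : Multiset X) = m}) →
      gen k c * a ∈ Submodule.span k
        (Zinbiel.wordMonomial k '' {w | w ≠ [] ∧ (w : Multiset X) = c ::ₘ m}) := by
    intro c m a ha
    induction ha using Submodule.span_induction with
    | mem a ha =>
      obtain ⟨w, ⟨hw, rfl⟩, rfl⟩ := ha
      exact Submodule.subset_span ⟨c :: w, ⟨List.cons_ne_nil _ _, rfl⟩, (hcons c hw).symm⟩
    | zero => rw [mul_zero]; exact zero_mem _
    | add a b _ _ ha hb => rw [mul_add]; exact add_mem ha hb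
    | smul r a _ ha => rw [mul_smul_comm]; exact Submodule.smul_mem _ _ ha
  match w₁, h₁ with
  | [c], _ =>
    exact Submodule.subset_span ⟨c :: w₂, ⟨List.cons_ne_nil _ _, rfl⟩, (hcons c h₂).symm⟩
  | c :: d :: w, _ =>
    rw [← hcons c (List.cons_ne_nil d w), mul_mul_eq, ← mul_add]
    have h := hgen c (((d :: w : List X) : Multiset X) + w₂) _ (add_mem
      (ih _ (by simp at hl ⊢; omega) (d :: w) w₂ (List.cons_ne_nil _ _) h₂ rfl) (by
        rw [add_comm]
        exact ih _ (by simp at hl ⊢; omega) w₂ (d :: w) h₂ (List.cons_ne_nil _ _) rfl))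
    rwa [← Multiset.cons_add] at h

theorem component_le_span_wordMonomial (c : Multiset X) :
    component k c ≤
      Submodule.span k (Zinbiel.wordMonomial k '' {w | w ≠ [] ∧ (w : Multiset X) = c}) := by
  refine Submodule.span_le.mpr ?_
  rintro _ ⟨t, ht, rfl⟩
  obtain rfl : t.content = c := ht
  induction t using FreeMagma.recOnMul with
  | ih1 d => exact Submodule.subset_span ⟨[d], ⟨List.cons_ne_nil _ _, rfl⟩, rfl⟩
  | ih2 s t hs ht =>
    rw [map_mul, FreeMagma.content_mul]
    simp only [SetLike.mem_coe] at hs ht ⊢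
    generalize monomial k s = a at hs ⊢
    generalize monomial k t = b at ht ⊢
    induction hs using Submodule.span_induction with
    | mem a ha =>
      obtain ⟨w₁, ⟨h₁, e₁⟩, rfl⟩ := ha
      induction ht using Submodule.span_induction with
      | mem b hb =>
        obtain ⟨w₂, ⟨h₂, e₂⟩, rfl⟩ := hb
        rw [← e₁, ← e₂]
        exact wordMonomial_mul_mem w₁ w₂ h₁ h₂
      | zero => rw [mul_zero]; exact zero_mem _
      | add a b _ _ ha hb => rw [mul_add]; exact add_mem ha hb
      | smul r a _ ha => rw [mul_smul_comm]; exact Submodule.smul_mem _ _ ha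
    | zero => rw [zero_mul]; exact zero_mem _
    | add a b _ _ ha hb => rw [add_mul]; exact add_mem ha hb
    | smul r a _ ha => rw [smul_mul_assoc]; exact Submodule.smul_mem _ _ ha

/-- The function attached to a word is the product of the inverses of the partial sums of the
mirror word. -/
theorem exists_monomial_eq_wordMonomial {K : Type w} [Field K] (x : X → K) (hx : ∀ c, x c ≠ 0)
    (w : List X) (hw : w ≠ []) : ∃ t : FreeMagma X, monomial k t = Zinbiel.wordMonomial k w ∧
      t.content = (w : Multiset X) ∧ t.ratio x = prefixProd 0 (w.map x).reverse := by
  induction w with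
  | nil => exact absurd rfl hw
  | cons c w ih =>
    rcases w with _ | ⟨d, w⟩
    · exact ⟨.of c, rfl, rfl, by simp [FreeMagma.ratio_of, prefixProd_cons]⟩
    · obtain ⟨t, h₁, h₂, h₃⟩ := ih (List.cons_ne_nil _ _)
      refine ⟨.of c * t, ?_, ?_, ?_⟩
      · rw [map_mul, h₁]
        rfl
      · rw [FreeMagma.content_mul, h₂]
        rfl
      · rw [FreeMagma.ratio_mul, h₃, FreeMagma.weight_eq, FreeMagma.weight_eq, h₂,
          FreeMagma.content_of, FreeMagma.ratio_of, List.map_cons (a := c), List.reverse_cons,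
          prefixProd_concat, Multiset.map_singleton, Multiset.sum_singleton, Multiset.map_coe,
          Multiset.sum_coe, List.sum_reverse, zero_add, add_comm (x c)]
        have := hx c
        field_simp

theorem subst_monomial {Y : Type w} (v : X → FreeZinbiel k Y) (τ : X → FreeMagma Y)
    (h : ∀ c, v c = monomial k (τ c)) (t : FreeMagma X) :
    subst v (monomial k t) = monomial k (FreeMagma.lift τ t) := by
  induction t using FreeMagma.recOnMul with
  | ih1 c => rw [monomial_of, subst_gen, h, FreeMagma.lift_of]
  | ih2 s t hs ht => rw [map_mul, subst_mul, hs, ht, map_mul, map_mul]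

end Words

end FreeZinbiel

/-! ### Linear independence of the permutational moulds -/

section Polynomial

open Polynomial

variable {k : Type u} [Field k] {n : ℕ}

theorem monic_sum_X_pow {ι : Type*} (E : Finset ι) (hE : E.Nonempty) (e : ι → ℕ)
    (he : Function.Injective e) :
    (∑ j ∈ E, (X : k[X]) ^ e j).Monic ∧ (∑ j ∈ E, (X : k[X]) ^ e j).natDegree = E.sup e := by
  classical
  obtain ⟨m, hm, hsup⟩ := E.exists_mem_eq_sup hE e
  have hdeg : (∑ j ∈ E.erase m, (X : k[X]) ^ e j).degree < (e m : ℕ) := by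
    refine (degree_sum_le _ _).trans_lt ((Finset.sup_lt_iff (by simp)).mpr fun j hj => ?_)
    rw [degree_X_pow]
    have hle : e j ≤ e m := hsup ▸ Finset.le_sup (Finset.mem_of_mem_erase hj)
    exact_mod_cast lt_of_le_of_ne hle fun h => (Finset.ne_of_mem_erase hj) (he h)
  rw [← Finset.add_sum_erase _ _ hm, hsup]
  exact ⟨monic_X_pow_add hdeg, by
    rw [natDegree_add_eq_left_of_degree_lt (by rwa [degree_X_pow]), natDegree_X_pow]⟩

theorem le_sup_Iic (σ : Equiv.Perm (Fin n)) (i : Fin n) :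
    (i : ℕ) ≤ (Finset.Iic i).sup fun j => (σ j : ℕ) := by
  have hsub : (Finset.Iic i).image (fun j => (σ j : ℕ)) ⊆
      Finset.range (((Finset.Iic i).sup fun j => (σ j : ℕ)) + 1) := by
    intro c hc
    obtain ⟨j, hj, rfl⟩ := Finset.mem_image.mp hc
    exact Finset.mem_range.mpr
      (Nat.lt_succ_of_le (Finset.le_sup (f := fun j => (σ j : ℕ)) hj))
  have := Finset.card_le_card hsub
  rw [Finset.card_image_of_injective _ (f := fun j => (σ j : ℕ))
    (Fin.val_injective.comp σ.injective), Fin.card_Iic,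
    Finset.card_range] at this
  omega

/-- The sum of the prefix maxima of a permutation is minimal only for the identity. -/
theorem sum_sup_Iic_lt {σ : Equiv.Perm (Fin n)} (hσ : σ ≠ 1) :
    ∑ i : Fin n, (Finset.Iic i).sup (fun j => ((1 : Equiv.Perm (Fin n)) j : ℕ)) <
      ∑ i : Fin n, (Finset.Iic i).sup fun j => (σ j : ℕ) := by
  have h1 : ∀ i : Fin n, (Finset.Iic i).sup (fun j => ((1 : Equiv.Perm (Fin n)) j : ℕ)) = i :=
    fun i => le_antisymm (Finset.sup_le fun j hj => Fin.le_def.mp (Finset.mem_Iic.mp hj))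
      (le_sup_Iic 1 i)
  simp only [h1]
  refine lt_of_le_of_ne (Finset.sum_le_sum fun i _ => le_sup_Iic σ i) fun h => hσ ?_
  have heq := (Finset.sum_eq_sum_iff_of_le fun i _ => le_sup_Iic σ i).mp h
  have hle : ∀ i, σ i ≤ i := fun i => by
    have := Finset.le_sup (f := fun j => (σ j : ℕ)) (Finset.mem_Iic.mpr (le_refl i))
    rw [← heq i (Finset.mem_univ i)] at this
    exact this
  -- a permutation with `σ i ≤ i` for all `i` is the identity, as `∑ σ i = ∑ i`
  have hsum : ∑ i, (σ i : ℕ) = ∑ i : Fin n, (i : ℕ) := Equiv.sum_comp σ fun i : Fin n => (i : ℕ)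
  have := (Finset.sum_eq_sum_iff_of_le (f := fun i => (σ i : ℕ))
    (g := fun i : Fin n => (i : ℕ)) fun i _ => hle i).mp hsum
  ext i
  exact this i (Finset.mem_univ i)

end Polynomial

namespace Mould

variable {k : Type u} [Field k] {n : ℕ}

theorem act_perm (σ τ : Equiv.Perm (Fin n)) : act σ (perm k τ) = perm k (σ * τ) := by
  simp only [perm, map_prod, map_inv₀, map_sum, act_u, Equiv.Perm.mul_apply]

/-- Under the substitution `u_j = t ^ j`, the denominator of `f_σ` becomes a monic polynomial in
`t`, the degree of which is the sum of the prefix maxima of `σ`. So `f_1` dominates all the other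
permutational moulds as `t → ∞`. -/
theorem coeff_one_eq_zero {c : Equiv.Perm (Fin n) → k} (hc : ∑ σ, c σ • perm k σ = 0) :
    c 1 = 0 := by
  classical
  let D : Equiv.Perm (Fin n) → MvPolynomial (Fin n) k := fun σ =>
    ∏ i : Fin n, ∑ j ∈ Finset.Iic i, MvPolynomial.X (σ j)
  have hD : ∀ σ, algebraMap _ (Mould k n) (D σ) = (perm k σ)⁻¹ := by
    intro σ
    simp only [D, map_prod, map_sum, perm, u, Finset.prod_inv_distrib, inv_inv]
  have hne : ∀ σ : Equiv.Perm (Fin n), perm k σ ≠ 0 := by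
    intro σ
    refine Finset.prod_ne_zero_iff.mpr fun i _ => inv_ne_zero ?_
    exact sum_ne_zero ((algebraicIndependent_u k n).comp σ σ.injective)
      ⟨i, Finset.mem_Iic.mpr le_rfl⟩
  -- the linear relation, multiplied by all the denominators
  have hpoly : ∑ σ, c σ • ∏ τ ∈ Finset.univ.erase σ, D τ = 0 := by
    refine IsFractionRing.injective (MvPolynomial (Fin n) k) (Mould k n) ?_
    have hsmul : ∀ (r : k) (p : MvPolynomial (Fin n) k),
        algebraMap _ (Mould k n) (r • p) = r • algebraMap _ (Mould k n) p := fun r p =>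
      map_smul (IsScalarTower.toAlgHom k (MvPolynomial (Fin n) k) (Mould k n)) r p
    have hterm : ∀ σ, c σ • ∏ τ ∈ Finset.univ.erase σ, (perm k τ)⁻¹ =
        (∏ τ, (perm k τ)⁻¹) * (c σ • perm k σ) := by
      intro σ
      rw [← Finset.mul_prod_erase _ _ (Finset.mem_univ σ), mul_smul_comm, mul_right_comm,
        inv_mul_cancel₀ (hne σ), one_mul]
    simp only [map_sum, hsmul, map_prod, hD, map_zero, hterm]
    rw [← Finset.mul_sum, hc, mul_zero]
  -- the substitution `u_j = t ^ j`
  let ev := MvPolynomial.aeval (R := k) fun j : Fin n => (Polynomial.X : Polynomial k) ^ (j : ℕ)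
  let d : Equiv.Perm (Fin n) → ℕ := fun σ => ∑ i : Fin n, (Finset.Iic i).sup fun j => (σ j : ℕ)
  have hev : ∀ σ, (ev (D σ)).Monic ∧ (ev (D σ)).natDegree = d σ := by
    intro σ
    have hm := fun i : Fin n => monic_sum_X_pow (k := k) (Finset.Iic i)
      ⟨i, Finset.mem_Iic.mpr le_rfl⟩ (fun j => (σ j : ℕ)) (Fin.val_injective.comp σ.injective)
    have hval : ev (D σ) = ∏ i : Fin n, ∑ j ∈ Finset.Iic i, Polynomial.X ^ (σ j : ℕ) := by
      simp only [ev, D, map_prod, map_sum, MvPolynomial.aeval_X]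
    rw [hval]
    refine ⟨Polynomial.monic_prod_of_monic _ _ fun i _ => (hm i).1, ?_⟩
    rw [Polynomial.natDegree_prod_of_monic _ _ fun i _ => (hm i).1]
    exact Finset.sum_congr rfl fun i _ => (hm i).2
  have hprod : ∀ σ, (∏ τ ∈ Finset.univ.erase σ, ev (D τ)).Monic ∧
      (∏ τ ∈ Finset.univ.erase σ, ev (D τ)).natDegree + d σ = ∑ τ, d τ := by
    intro σ
    refine ⟨Polynomial.monic_prod_of_monic _ _ fun τ _ => (hev τ).1, ?_⟩
    rw [Polynomial.natDegree_prod_of_monic _ _ fun τ _ => (hev τ).1,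
      Finset.sum_congr rfl fun τ _ => (hev τ).2, Finset.sum_erase_add _ _ (Finset.mem_univ σ)]
  -- the leading term of the summand of the identity is not attained by any other summand
  have hzero := congrArg (fun p => (ev p).coeff (∏ τ ∈ Finset.univ.erase 1, ev (D τ)).natDegree)
    hpoly
  simp only [map_sum, map_smul, map_prod, map_zero, Polynomial.coeff_zero,
    Polynomial.finsetSum_coeff, Polynomial.coeff_smul, smul_eq_mul] at hzero
  rw [Finset.sum_eq_single 1] at hzero
  · rwa [(hprod 1).1.coeff_natDegree, mul_one] at hzero
  · intro σ _ hσ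
    rw [Polynomial.coeff_eq_zero_of_natDegree_lt, mul_zero]
    have h1 := (hprod 1).2
    have h2 := (hprod σ).2
    have h3 : d 1 < d σ := sum_sup_Iic_lt hσ
    omega
  · exact fun h => absurd (Finset.mem_univ _) h

/-- The coefficient of `f_τ` in a linear relation is that of `f_1` in its translate by `τ⁻¹`. -/
theorem linearIndependent_perm : LinearIndependent k (perm k : Equiv.Perm (Fin n) → Mould k n) := by
  refine Fintype.linearIndependent_iff.mpr fun c hc τ => ?_
  have h := congrArg (act τ⁻¹) hc
  simp only [map_sum, map_smul, act_perm, map_zero] at h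
  rw [← Equiv.sum_comp (Equiv.mulLeft τ)] at h
  simp only [Equiv.coe_mulLeft, inv_mul_cancel_left] at h
  simpa using coeff_one_eq_zero (c := fun σ => c (τ * σ)) h

end Mould

/-! ### From the Zinbiel operad to moulds -/

/-- The inputs of `f ∘_i g` are those of `g` and those of `f` other than the `i`-th. -/
theorem sum_innerPos_outerPos {M : Type*} [AddCommMonoid M] {m n N : ℕ+}
    (h : (N : ℕ) + 1 = m + n) (i : Fin m) (y : Fin N → M) :
    ∑ j : Fin m, (if j = i then ∑ l : Fin n, y (innerPos h i l) else y (outerPos h i j)) =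
      ∑ a, y a := by
  have hi := i.isLt
  have hn := n.pos
  let z : ℕ → M := fun a => if ha : a < N then y ⟨a, ha⟩ else 0
  have hz : ∀ a : Fin N, z a = y a := fun a => dif_pos a.isLt
  have hinner : ∑ l : Fin n, y (innerPos h i l) = ∑ b ∈ Finset.range n, z (i + b) := by
    rw [← Fin.sum_univ_eq_sum_range (fun b => z (i + b))]
    exact Finset.sum_congr rfl fun l _ => (hz (innerPos h i l)).symm
  have hl : ∑ j : Fin m,
      (if j = i then ∑ l : Fin n, y (innerPos h i l) else y (outerPos h i j)) =
      ∑ a ∈ Finset.range m, if a = i then ∑ b ∈ Finset.range n, z (i + b)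
        else z (if a ≤ i then a else a + n - 1) := by
    rw [← Fin.sum_univ_eq_sum_range (fun a => if a = i then ∑ b ∈ Finset.range n, z (i + b)
        else z (if a ≤ (i : ℕ) then a else a + n - 1)), hinner]
    refine Finset.sum_congr rfl fun j _ => ?_
    rw [← hz (outerPos h i j)]
    simp only [Fin.ext_iff, outerPos, Fin.le_def]
  have hr : ∑ a, y a = ∑ a ∈ Finset.range N, z a := by
    rw [← Fin.sum_univ_eq_sum_range z]
    exact Finset.sum_congr rfl fun a _ => (hz a).symm
  have hm : Finset.range m = Finset.range (i + 1 + (m - i - 1)) := congrArg _ (by omega)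
  have hN : Finset.range N = Finset.range (i + n + (m - i - 1)) := congrArg _ (by omega)
  rw [hl, hr, hm, hN]
  simp only [Finset.sum_range_add,
    Finset.sum_range_one]
  rw [if_pos (add_zero _)]
  congr 1
  · congr 1
    refine Finset.sum_congr rfl fun a ha => ?_
    have := Finset.mem_range.mp ha
    rw [if_neg this.ne, if_pos this.le]
  · refine Finset.sum_congr rfl fun a _ => ?_
    rw [if_neg (by omega), if_neg (by omega)]
    congr 1
    omega

namespace Zinbiel

variable {k : Type u} [Field k]

variable (k) in
/-- The mould of an operation of the Zinbiel operad: the value at `{1, …, n}` of its image in the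
half-shuffle algebra of the variables `u_1, …, u_n`. -/
noncomputable def toMould (n : ℕ) : Zinbiel k n →ₗ[k] Mould k n where
  toFun f := FreeZinbiel.toHalfShuffle k (Mould.u k : Fin n → Mould k n)
    (fun _ => Mould.sum_ne_zero (Mould.algebraicIndependent_u k n)) f.1 Finset.univ
  map_add' f g := by
    rw [Submodule.coe_add, map_add]
    rfl
  map_smul' r f := by
    rw [Submodule.coe_smul, map_smul]
    rfl

theorem toMould_monomial {n : ℕ} (t : FreeMagma (Fin n))
    (ht : t.content = (Finset.univ : Finset (Fin n)).val)
    (h : FreeZinbiel.monomial k t ∈ Zinbiel k n) :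
    toMould k n ⟨FreeZinbiel.monomial k t, h⟩ = t.ratio (Mould.u k) :=
  (FreeZinbiel.toHalfShuffle_monomial
    (hx := fun _ => Mould.sum_ne_zero (Mould.algebraicIndependent_u k n)) t Finset.univ).trans
    (if_pos ht.symm)

/-- An additive statement on operations of the Zinbiel operad holds if it holds for the
nonassociative monomials in which each generator occurs once. -/
theorem induction_monomial {n : ℕ} {p : Zinbiel k n → Prop}
    (mem : ∀ (t : FreeMagma (Fin n)) (_ : t.content = (Finset.univ : Finset (Fin n)).val)
      (h : FreeZinbiel.monomial k t ∈ Zinbiel k n), p ⟨_, h⟩)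
    (zero : p 0) (add : ∀ f g, p f → p g → p (f + g)) (smul : ∀ (r : k) f, p f → p (r • f))
    (f : Zinbiel k n) : p f := by
  obtain ⟨f, hf⟩ := f
  induction hf using Submodule.span_induction with
  | mem f hf =>
    obtain ⟨t, ht, rfl⟩ := hf
    exact mem t ht _
  | zero => exact zero
  | add f g hf hg h₁ h₂ => exact add ⟨f, hf⟩ ⟨g, hg⟩ h₁ h₂
  | smul r f hf h => exact smul r ⟨f, hf⟩ h

/-- The composition is linear in the inner operation, because the generator it is substituted for
occurs exactly once in the outer one. -/
theorem isLinearMap_subst_compArgs {m n N : ℕ+} (h : (N : ℕ) + 1 = m + n) (i : Fin m)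
    (t : FreeMagma (Fin m)) :
    (t.content.count i = 0 → ∃ e, ∀ g : FreeZinbiel k (Fin n),
      FreeZinbiel.subst (compArgs h i g) (FreeZinbiel.monomial k t) = e) ∧
    (t.content.count i = 1 → IsLinearMap k fun g : FreeZinbiel k (Fin n) =>
      FreeZinbiel.subst (compArgs h i g) (FreeZinbiel.monomial k t)) := by
  induction t using FreeMagma.recOnMul with
  | ih1 c =>
    simp only [FreeZinbiel.monomial_of, FreeZinbiel.subst_gen, FreeMagma.content_of,
      Multiset.count_singleton]
    refine ⟨fun hc => ⟨_, fun g => if_neg fun hci => ?_⟩, fun hc => ?_⟩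
    · rw [if_pos hci.symm] at hc
      exact one_ne_zero hc
    · have hci : c = i := by
        by_contra hci
        rw [if_neg fun hh => hci hh.symm] at hc
        exact zero_ne_one hc
      simp only [compArgs, if_pos hci]
      exact LinearMap.isLinear _
  | ih2 s t hs ht =>
    simp only [map_mul, FreeZinbiel.subst_mul, FreeMagma.content_mul, Multiset.count_add]
    constructor
    · intro hc
      obtain ⟨e, he⟩ := hs.1 (by omega)
      obtain ⟨e', he'⟩ := ht.1 (by omega)
      exact ⟨e * e', fun g => by rw [he, he']⟩
    · intro hc
      rcases Nat.eq_zero_or_pos (s.content.count i) with h0 | h0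
      · obtain ⟨e, he⟩ := hs.1 h0
        have hl := ht.2 (by omega)
        simp only [he]
        exact ⟨fun g g' => by rw [hl.map_add, mul_add],
          fun r g => by rw [hl.map_smul, mul_smul_comm]⟩
      · obtain ⟨e, he⟩ := ht.1 (by omega)
        have hl := hs.2 (by omega)
        simp only [he]
        exact ⟨fun g g' => by rw [hl.map_add, add_mul],
          fun r g => by rw [hl.map_smul, smul_mul_assoc]⟩

/-- By `FreeMagma.ratio_lift`, the weights of the substituted monomials are the arguments of the
outer mould, and the inner monomial contributes its weight `u_i + ⋯ + u_{i+n-1}` and its mould. -/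
theorem toMould_comp_monomial {m n N : ℕ+} (h : (N : ℕ) + 1 = m + n) (i : Fin m)
    {s : FreeMagma (Fin m)} (hs : s.content = (Finset.univ : Finset (Fin m)).val)
    (hs' : FreeZinbiel.monomial k s ∈ Zinbiel k m)
    {t : FreeMagma (Fin n)} (ht : t.content = (Finset.univ : Finset (Fin n)).val)
    (ht' : FreeZinbiel.monomial k t ∈ Zinbiel k n) :
    toMould k N ((zinbielOperad k).comp h i ⟨_, hs'⟩ ⟨_, ht'⟩) =
      Mould.comp h i (toMould k m ⟨_, hs'⟩) (toMould k n ⟨_, ht'⟩) := by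
  let τ : Fin m → FreeMagma (Fin N) := fun j =>
    if j = i then FreeMagma.lift (fun l => FreeMagma.of (innerPos h i l)) t
    else FreeMagma.of (outerPos h i j)
  have hτ : ∀ j, compArgs h i (FreeZinbiel.monomial k t) j = FreeZinbiel.monomial k (τ j) := by
    intro j
    simp only [compArgs, τ]
    split_ifs with hj
    · exact FreeZinbiel.subst_monomial _ _ (fun l => (FreeZinbiel.monomial_of _).symm) t
    · exact (FreeZinbiel.monomial_of _).symm
  have hsubst : FreeZinbiel.subst (compArgs h i (FreeZinbiel.monomial k t))
      (FreeZinbiel.monomial k s) = FreeZinbiel.monomial k (FreeMagma.lift τ s) :=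
    FreeZinbiel.subst_monomial _ τ hτ s
  have hcontent : (FreeMagma.lift τ s).content = (Finset.univ : Finset (Fin N)).val := by
    have hτc : ∀ j, (τ j).content = if j = i then ∑ l : Fin n, {innerPos h i l}
        else {outerPos h i j} := by
      intro j
      simp only [τ]
      split_ifs
      · rw [FreeMagma.content_lift, ht]
        rfl
      · rfl
    rw [FreeMagma.content_lift, hs]
    change ∑ j : Fin m, (τ j).content = _
    simp only [hτc]
    rw [sum_innerPos_outerPos h i fun a => ({a} : Multiset (Fin N)),
      Finset.sum_multiset_singleton]
  have hweight : ∀ j, (τ j).weight (Mould.u k) = Mould.outerArgs k h i j := by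
    intro j
    simp only [τ, Mould.outerArgs]
    split_ifs
    · rw [FreeMagma.weight_lift, FreeMagma.weight_eq, ht]
      rfl
    · rfl
  have hmem : FreeZinbiel.monomial k (FreeMagma.lift τ s) ∈ Zinbiel k N :=
    hsubst ▸ subst_compArgs_mem h i hs' ht'
  have hcomp : (zinbielOperad k).comp h i ⟨_, hs'⟩ ⟨_, ht'⟩ =
      (⟨FreeZinbiel.monomial k (FreeMagma.lift τ s), hmem⟩ : Zinbiel k N) := Subtype.ext hsubst
  have hne : ∀ j, (τ j).weight (Mould.u k) ≠ 0 := fun j => by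
    rw [hweight]
    simpa using Mould.sum_ne_zero (Mould.outerArgs_independent k h i)
      (Finset.singleton_nonempty j)
  rw [hcomp, toMould_monomial _ hcontent, toMould_monomial _ hs, toMould_monomial _ ht,
    FreeMagma.ratio_lift _ _ _ hne, hs]
  change _ * ∏ j : Fin m, (τ j).weight (Mould.u k) * (τ j).ratio (Mould.u k) = _
  rw [Finset.prod_eq_single i]
  · have hi : (τ i).ratio (Mould.u k) = t.ratio (Mould.innerArgs k h i) := by
      simp only [τ, if_true]
      exact FreeMagma.ratio_lift_of _ _ t
    have hwi : Mould.outerArgs k h i i = ∑ l : Fin n, Mould.u k (innerPos h i l) := if_pos rfl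
    have hf := FreeMagma.map_ratio
      (Mould.subst (Mould.outerArgs k h i) (Mould.outerArgs_independent k h i)).toRingHom
      (Mould.u k) s
    have hg := FreeMagma.map_ratio
      (Mould.subst (Mould.innerArgs k h i) (Mould.innerArgs_independent k h i)).toRingHom
      (Mould.u k) t
    simp only [AlgHom.toRingHom_eq_coe, RingHom.coe_coe, Mould.subst_u] at hf hg
    rw [Mould.comp, hf, hg, hi]
    simp only [hweight, hwi]
    ring
  · intro j _ hj
    have hj' : τ j = FreeMagma.of (outerPos h i j) := if_neg hj
    rw [hj', FreeMagma.weight_of, FreeMagma.ratio_of, mul_inv_cancel₀ (Mould.u_ne_zero _)]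
  · exact fun hh => absurd (Finset.mem_univ _) hh

theorem toMould_comp {m n N : ℕ+} (h : (N : ℕ) + 1 = m + n) (i : Fin m)
    (f : (zinbielOperad k).Obj m) (g : (zinbielOperad k).Obj n) :
    toMould k N ((zinbielOperad k).comp h i f g) =
      Mould.comp h i (toMould k m f) (toMould k n g) := by
  have hleft := Mould.isLinearMap_comp_left (k := k) h i (toMould k n g)
  have hadd : ∀ f f' : Zinbiel k m, (zinbielOperad k).comp h i (f + f') g =
      (zinbielOperad k).comp h i f g + (zinbielOperad k).comp h i f' g := fun f f' =>
    Subtype.ext (map_add (FreeZinbiel.subst (compArgs h i g.1)) f.1 f'.1)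
  have hsmul : ∀ (r : k) (f : Zinbiel k m), (zinbielOperad k).comp h i (r • f) g =
      r • (zinbielOperad k).comp h i f g := fun r f =>
    Subtype.ext (map_smul (FreeZinbiel.subst (compArgs h i g.1)) r f.1)
  have hzero : (zinbielOperad k).comp h i 0 g = 0 :=
    Subtype.ext (map_zero (FreeZinbiel.subst (compArgs h i g.1)))
  refine induction_monomial (p := fun f => toMould k N ((zinbielOperad k).comp h i f g) =
    Mould.comp h i (toMould k m f) (toMould k n g)) (fun s hs hs' => ?_) ?_ ?_ ?_ f
  · have hright := Mould.isLinearMap_comp_right (k := k) h i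
      (toMould k m ⟨FreeZinbiel.monomial k s, hs'⟩)
    have hlin := (isLinearMap_subst_compArgs (k := k) h i s).2 (by
      rw [hs]
      exact Multiset.count_eq_one_of_mem Finset.univ.nodup (Finset.mem_univ i))
    have hadd : ∀ g g' : Zinbiel k n,
        (zinbielOperad k).comp h i ⟨FreeZinbiel.monomial k s, hs'⟩ (g + g') =
        (zinbielOperad k).comp h i ⟨FreeZinbiel.monomial k s, hs'⟩ g +
        (zinbielOperad k).comp h i ⟨FreeZinbiel.monomial k s, hs'⟩ g' := fun g g' =>
      Subtype.ext (hlin.map_add g.1 g'.1)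
    have hsmul : ∀ (r : k) (g : Zinbiel k n),
        (zinbielOperad k).comp h i ⟨FreeZinbiel.monomial k s, hs'⟩ (r • g) =
        r • (zinbielOperad k).comp h i ⟨FreeZinbiel.monomial k s, hs'⟩ g := fun r g =>
      Subtype.ext (hlin.map_smul r g.1)
    have hzero : (zinbielOperad k).comp h i ⟨FreeZinbiel.monomial k s, hs'⟩ 0 = 0 :=
      Subtype.ext hlin.map_zero
    refine induction_monomial (p := fun g => toMould k N ((zinbielOperad k).comp h i _ g) =
      Mould.comp h i _ (toMould k n g))
      (fun t ht ht' => toMould_comp_monomial h i hs hs' ht ht') ?_ ?_ ?_ g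
    · exact (congrArg _ hzero).trans ((map_zero _).trans
        ((congrArg _ (map_zero _)).trans hright.map_zero).symm)
    · intro g g' h₁ h₂
      refine (congrArg _ (hadd g g')).trans ((map_add _ _ _).trans ?_)
      rw [map_add, hright.map_add, ← h₁, ← h₂]
    · intro r g h₁
      refine (congrArg _ (hsmul r g)).trans ((map_smul _ _ _).trans ?_)
      rw [map_smul, hright.map_smul, ← h₁]
  · exact (congrArg _ hzero).trans ((map_zero _).trans
      ((congrArg (Mould.comp h i · _) (map_zero _)).trans hleft.map_zero).symm)
  · intro f f' h₁ h₂
    refine (congrArg _ (hadd f f')).trans ((map_add _ _ _).trans ?_)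
    rw [map_add, hleft.map_add, ← h₁, ← h₂]
  · intro r f h₁
    refine (congrArg _ (hsmul r f)).trans ((map_smul _ _ _).trans ?_)
    rw [map_smul, hleft.map_smul, ← h₁]

theorem toMould_act {n : ℕ+} (σ : Equiv.Perm (Fin n)) (f : (zinbielOperad k).Obj n) :
    toMould k n ((zinbielOperad k).act σ f) = Mould.act σ (toMould k n f) := by
  have hlin : IsLinearMap k fun f : Zinbiel k n =>
      (show Zinbiel k n from (zinbielOperad k).act σ f) :=
    { map_add := fun f g => Subtype.ext (map_add (FreeZinbiel.subst _) f.1 g.1)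
      map_smul := fun r f => Subtype.ext (map_smul (FreeZinbiel.subst _) r f.1) }
  refine induction_monomial (p := fun f => toMould k n ((zinbielOperad k).act σ f) =
    Mould.act σ (toMould k n f)) (fun t ht ht' => ?_) ?_ ?_ ?_ f
  · have hsubst : FreeZinbiel.subst (fun j => FreeZinbiel.gen k (σ j)) (FreeZinbiel.monomial k t) =
        FreeZinbiel.monomial k (FreeMagma.lift (fun j => FreeMagma.of (σ j)) t) :=
      FreeZinbiel.subst_monomial _ _ (fun j => (FreeZinbiel.monomial_of _).symm) t
    have hmem : FreeZinbiel.monomial k (FreeMagma.lift (fun j => FreeMagma.of (σ j)) t) ∈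
        Zinbiel k n := hsubst ▸ subst_perm_mem σ ht'
    have hact : (zinbielOperad k).act σ ⟨_, ht'⟩ = (⟨_, hmem⟩ : Zinbiel k n) :=
      Subtype.ext hsubst
    have hcontent : (FreeMagma.lift (fun j => FreeMagma.of (σ j)) t).content =
        (Finset.univ : Finset (Fin n)).val := by
      rw [FreeMagma.content_lift, ht]
      change ∑ j, ({σ j} : Multiset (Fin n)) = _
      rw [Equiv.sum_comp σ fun j => ({j} : Multiset (Fin n)), Finset.sum_multiset_singleton]
    have hmap := FreeMagma.map_ratio (Mould.act (k := k) σ).toRingHom (Mould.u k) t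
    simp only [AlgHom.toRingHom_eq_coe, RingHom.coe_coe, Mould.act_u] at hmap
    rw [hact, toMould_monomial _ hcontent, toMould_monomial _ ht, hmap,
      FreeMagma.ratio_lift_of]
  · exact (congrArg _ hlin.map_zero).trans (by simp only [map_zero])
  · intro f g h₁ h₂
    refine (congrArg _ (hlin.map_add f g)).trans ?_
    rw [map_add, map_add, map_add, ← h₁, ← h₂]
  · intro r f h₁
    refine (congrArg _ (hlin.map_smul r f)).trans ?_
    rw [map_smul, map_smul, map_smul, ← h₁]

/-- Words grow on the left and partial sums on the right, whence the mirror image. -/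
theorem toMould_ofPerm {n : ℕ+} (σ : Equiv.Perm (Fin n)) :
    toMould k n (ofPerm k σ) = Mould.perm k (σ * Fin.revPerm) := by
  have hne : List.ofFn σ ≠ [] := fun h => n.pos.ne' (by simpa using congrArg List.length h)
  obtain ⟨t, h₁, h₂, h₃⟩ := FreeZinbiel.exists_monomial_eq_wordMonomial (k := k)
    (Mould.u k : Fin n → Mould k n) Mould.u_ne_zero (List.ofFn σ) hne
  have ht : t.content = (Finset.univ : Finset (Fin n)).val := by
    rw [h₂, ← Fin.univ_val_map]
    exact congrArg Finset.val (Finset.map_univ_equiv σ)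
  have hmem : FreeZinbiel.monomial k t ∈ Zinbiel k n := h₁ ▸ (ofPerm k σ).2
  have hσ : ofPerm k σ = ⟨FreeZinbiel.monomial k t, hmem⟩ := Subtype.ext h₁.symm
  rw [hσ, toMould_monomial t ht, h₃, Mould.perm_eq_prefixProd_ofFn, List.map_ofFn]
  congr 1
  refine List.ext_getElem (by simp) fun a ha _ => ?_
  rw [List.length_reverse, List.length_ofFn] at ha
  simp only [List.getElem_reverse, List.getElem_ofFn, List.length_ofFn, Function.comp_apply,
    Equiv.Perm.mul_apply, Fin.revPerm_apply]
  congr 2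
  apply Fin.ext
  simp only [Fin.val_rev]
  omega

theorem span_range_ofPerm (n : ℕ+) :
    Submodule.span k (Set.range (ofPerm k : Equiv.Perm (Fin n) → Zinbiel k n)) = ⊤ := by
  refine Submodule.map_injective_of_injective (Zinbiel k n).injective_subtype ?_
  rw [Submodule.map_span, Submodule.map_top, Submodule.range_subtype, ← Set.range_comp]
  refine le_antisymm (Submodule.span_le.mpr ?_) ?_
  · rintro _ ⟨σ, rfl⟩
    exact (ofPerm k σ).2
  · refine (FreeZinbiel.component_le_span_wordMonomial _).trans (Submodule.span_mono ?_)
    rintro _ ⟨w, ⟨-, hw⟩, rfl⟩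
    have hlen : w.length = n := by
      have := congrArg Multiset.card hw
      simpa using this
    have hnd : w.Nodup := Multiset.coe_nodup.mp (hw ▸ Finset.univ.nodup)
    have hinj : Function.Injective fun j : Fin n => w[(j : ℕ)]'(by omega) := fun a b hab =>
      Fin.ext ((List.Nodup.getElem_inj_iff hnd).mp hab)
    refine ⟨Equiv.ofBijective _ (Finite.injective_iff_bijective.mp hinj), ?_⟩
    change wordMonomial k (List.ofFn _) = _
    congr 1
    exact List.ext_getElem (by simp [hlen]) fun a _ _ => by simp

theorem linearIndependent_toMould_ofPerm (n : ℕ+) :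
    LinearIndependent k fun σ : Equiv.Perm (Fin n) => toMould k n (ofPerm k σ) := by
  simp only [toMould_ofPerm]
  exact Mould.linearIndependent_perm.comp (fun σ : Equiv.Perm (Fin n) => σ * Fin.revPerm)
    (mul_left_injective _)

theorem toMould_injective (n : ℕ+) : Function.Injective (toMould k n) := by
  rw [injective_iff_map_eq_zero]
  intro f hf
  have hmem : f ∈ Submodule.span k (Set.range (ofPerm k : Equiv.Perm (Fin n) → Zinbiel k n)) := by
    rw [span_range_ofPerm]
    trivial
  obtain ⟨c, rfl⟩ := (Submodule.mem_span_range_iff_exists_fun k).mp hmem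
  simp only [map_sum, map_smul] at hf
  have := Fintype.linearIndependent_iff.mp (linearIndependent_toMould_ofPerm n) c hf
  simp [this]

theorem range_toMould (n : ℕ+) : LinearMap.range (toMould k n) = Mould.permSpan k n := by
  rw [LinearMap.range_eq_map, ← span_range_ofPerm, Submodule.map_span, ← Set.range_comp,
    Mould.permSpan]
  congr 1
  have : (toMould k n ∘ ofPerm k : Equiv.Perm (Fin n) → Mould k n) =
      Mould.perm k ∘ Equiv.mulRight Fin.revPerm := funext toMould_ofPerm
  rw [this, Set.range_comp, Equiv.range_eq_univ, Set.image_univ]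

theorem toMould_one :
    toMould k (1 : ℕ+) (zinbielOperad k).one = (Mould.u k (n := (1 : ℕ+)) ⟨0, Nat.one_pos⟩)⁻¹ := by
  let c : Fin (1 : ℕ+) := ⟨0, Nat.one_pos⟩
  have h1 : (zinbielOperad k).one = (⟨FreeZinbiel.monomial k (FreeMagma.of c),
      (zinbielOperad k).one.2⟩ : Zinbiel k (1 : ℕ+)) := Subtype.ext (FreeZinbiel.monomial_of _).symm
  exact (congrArg _ h1).trans (toMould_monomial (FreeMagma.of c) rfl _)

end Zinbiel

/-! ### The suboperad of permutational moulds -/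

section Suboperad

variable (k : Type u) [Field k]

theorem mem_permutationalMoulds_iff {n : ℕ+} {f : Mould k n} :
    f ∈ permutationalMoulds k n ↔ ∃ a, Zinbiel.toMould k n a = f := by
  rw [← LinearMap.mem_range, Zinbiel.range_toMould]
  rfl

theorem isSuboperad_permutationalMoulds :
    (mouldOperad k).IsSuboperad (permutationalMoulds k) where
  one_mem := (mem_permutationalMoulds_iff k).mpr ⟨_, Zinbiel.toMould_one⟩
  comp_mem h i f g hf hg := by
    obtain ⟨a, rfl⟩ := (mem_permutationalMoulds_iff k).mp hf
    obtain ⟨b, rfl⟩ := (mem_permutationalMoulds_iff k).mp hg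
    exact (mem_permutationalMoulds_iff k).mpr ⟨_, Zinbiel.toMould_comp h i a b⟩
  act_mem σ f hf := by
    obtain ⟨a, rfl⟩ := (mem_permutationalMoulds_iff k).mp hf
    exact (mem_permutationalMoulds_iff k).mpr ⟨_, Zinbiel.toMould_act σ a⟩

theorem cycle_mem_permutationalMoulds (n : ℕ+) (f : Mould k n)
    (hf : f ∈ permutationalMoulds k n) : Mould.cycle n f ∈ permutationalMoulds k n := by
  classical
  change f ∈ Mould.permSpan k n at hf
  change _ ∈ Mould.permSpan k n
  induction hf using Submodule.span_induction with
  | mem f hf =>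
    obtain ⟨σ, rfl⟩ := hf
    have h1 : 1 ∈ shiftedPermWord σ := (Mould.shiftedPermWord_perm n.pos σ).mem_iff.mpr
      (List.mem_range'_1.mpr ⟨le_rfl, by have := n.pos; omega⟩)
    obtain ⟨a, w, hσ⟩ := List.append_of_mem h1
    rw [Mould.cycle_perm σ a w hσ]
    rcases neg_one_pow_eq_or (Mould k n) (1 :: w.reverse).length with h | h <;> rw [h]
    · rw [one_mul]
      exact Submodule.sum_mem _ fun τ _ => Submodule.subset_span ⟨τ, rfl⟩
    · rw [neg_one_mul]
      exact Submodule.neg_mem _ (Submodule.sum_mem _ fun τ _ => Submodule.subset_span ⟨τ, rfl⟩)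
  | zero => rw [map_zero]; exact zero_mem _
  | add f g _ _ hf hg => rw [map_add]; exact add_mem hf hg
  | smul r f _ hf => rw [map_smul]; exact Submodule.smul_mem _ _ hf

/-- The isomorphism from the Zinbiel operad to the operad of permutational moulds. -/
noncomputable def zinbielIso : PreOperad.Iso (zinbielOperad k)
    ((mouldOperad k).restrict (permutationalMoulds k) (isSuboperad_permutationalMoulds k)) where
  equiv n := (LinearEquiv.ofInjective (Zinbiel.toMould k n) (Zinbiel.toMould_injective n)).trans
    (LinearEquiv.ofEq _ _ (Zinbiel.range_toMould n))
  map_one := Subtype.ext Zinbiel.toMould_one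
  map_comp h i f g := Subtype.ext (Zinbiel.toMould_comp h i f g)
  map_act σ f := Subtype.ext (Zinbiel.toMould_act σ f)

end Suboperad

open Classical in
theorem mainTheorem4 (k : Type u) [Field k] :
    -- the anticyclic operad of moulds
    (mouldOperad k).IsAnticyclic (fun n => Mould.cycle (k := k) n) ∧
    -- the composition rule for the identity permutations
    (∀ {m n N : ℕ+} (h : (N : ℕ) + 1 = m + n) (i : Fin m),
      (mouldOperad k).comp h i (Mould.perm k (1 : Equiv.Perm (Fin m)))
          (Mould.perm k (1 : Equiv.Perm (Fin n))) =
        ∑ σ : Equiv.Perm (Fin N) with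
          (∃ w, IsShuffle (List.range' 1 i) (List.range' ((i : ℕ) + 1) (n - 1)) w ∧
            permWord σ = w ++ List.range' ((i : ℕ) + n) (m - i)),
          Mould.perm k σ) ∧
    -- the action of the cycle on the permutational moulds
    (∀ {n : ℕ+} (σ : Equiv.Perm (Fin n)) (a w : List ℕ), shiftedPermWord σ = a ++ 1 :: w →
      Mould.cycle n (Mould.perm k σ) = (-1) ^ (1 :: w.reverse).length *
        ∑ τ : Equiv.Perm (Fin n) with IsShuffle a (1 :: w.reverse) (permWord τ),
          Mould.perm k τ) ∧
    -- the permutational moulds span an anticyclic suboperad, isomorphic to Zinbiel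
    ∃ (hS : (mouldOperad k).IsSuboperad (permutationalMoulds k))
      (hγ : ∀ (n : ℕ+) (f : Mould k n), f ∈ permutationalMoulds k n →
        Mould.cycle n f ∈ permutationalMoulds k n),
      ((mouldOperad k).restrict (permutationalMoulds k) hS).IsAnticyclic
          (fun n f => ⟨Mould.cycle n f.1, hγ n f.1 f.2⟩) ∧
      ∃ φ : PreOperad.Iso (zinbielOperad k)
          ((mouldOperad k).restrict (permutationalMoulds k) hS),
        ∀ (n : ℕ+) (σ : Equiv.Perm (Fin n)),
          (φ.equiv n (Zinbiel.ofPerm k σ)).1 = Mould.perm k (σ * Fin.revPerm) := 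

  ⟨mouldOperad_isAnticyclic k, Mould.comp_perm_one, Mould.cycle_perm,
    isSuboperad_permutationalMoulds k, cycle_mem_permutationalMoulds k,
    (mouldOperad_isAnticyclic k).restrict _ _, zinbielIso k,
    fun _ σ => Zinbiel.toMould_ofPerm σ⟩
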